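/- **Setting.** Consider a family, indexed by a set $S$, of dimensions $n=n_s$, $p=p_s$ and of random matrices $X=(x_1,\dots,x_n)\in\mathcal M_{p,n}(\mathbb R)$; below, $O(1)$ and "constants" are uniform in $s\in S$ and in the column index $i\in[n]$. Assume: 1. $X\propto\mathcal E_2$: there are constants $C,c>0$ such that for every $g:\mathcal M_{p,n}\to\mathbb R$ that is $1$-Lipschitz for the Frobenius norm, $g(X)$ is integrable and $\mathbb P(|g(X)-\mathbb E[g(X)]|\ge t)\le Ce^{-(t/c)^2}$ for all $t>0$; 2. the columns $x_1,\dots,x_n\in\mathbb R^p$ are independent; 3. $ap\le n\le bp$ for two constants $a,b>0$; 4. $\sup_i\|\mathbb E[x_i]\|\le O(1)$ and $\inf_i\frac1n\operatorname{tr}\mathbb E[x_ix_i^T]\ge\kappa$ for a constant $\kappa>0$; 5. $f:\mathbb R\to\mathbb R$ is a fixed twice differentiable function (it does not depend on $s$) with $\|f''\|_\infty<\infty$, and there are constants $\lambda,\varepsilon>0$ with $\|f'\|_\infty\le\lambda$ and $1-\frac\lambda n\mathbb E[\|XX^T\|]\ge2\varepsilon$, where $\|\cdot\|$ is the spectral norm.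 Set $\mathcal A_Y=\{\frac\lambda n\|XX^T\|\le1-\varepsilon\}$. Let $Y$, $Y_{-i}$ and $y_{-i}(t)$, $t\in[0,1]$, be the solutions of $$Y=\frac1n\sum_{j=1}^nf(x_j^TY)x_j,\qquad Y_{-i}=\frac1n\sum_{j\ne i}f(x_j^TY_{-i})x_j,\qquad y_{-i}(t)=\frac1n\sum_{j\ne i}f(x_j^Ty_{-i}(t))x_j+\frac tnf(x_i^Ty_{-i}(t))x_i,$$ and let $Q_{-i}=\big(I_p-\frac1n\sum_{j\neq i}f'(x_j^TY_{-i})x_jx_j^T\big)^{-1}$. **Proposition.** On $\mathcal A_Y$ the three equations have unique solutions and the inverse defining $Q_{-i}$ exists; $\mathbb P(\mathcal A_Y)>0$ and $\mathbb P(\mathcal A_Y^c)\le Ce^{-cn}$ for constants $C,c>0$. For all $i\in[n]$, $$M_i=\mathbb E\Big[\sup_{t\in[0,1]}|x_i^Ty_{-i}(t)|\ \Big|\ \mathcal A_Y\Big]\le O(1).$$ If moreover $\|f\|_\infty<\infty$, then, for all $i\in[n]$, $\big\|Y-Y_{-i}-\frac1nf(x_i^TY)Q_{-i}x_i\big\|\in0\pm\mathcal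 E_2(1/n)\ |\ e^{-n}$ with concentration zone $\mathcal A_Y$, that is, there are constants $C,c>0$ with $$\mathbb P(\mathcal A_Y^c)\le Ce^{-n/c},\qquad \mathbb P\Big(\big\|Y-Y_{-i}-\tfrac1nf(x_i^TY)Q_{-i}x_i\big\|\ge t\ \Big|\ \mathcal A_Y\Big)\le Ce^{-(nt/c)^2}\quad\text{for all }t>0.$$ -/

import Mathlib

open MeasureTheory ProbabilityTheory

noncomputable section

namespace RobustRegression

/-! ### Concentration of families of random vectors -/

section Concentration

universe u v w

variable {S : Type u} {Ω : S → Type v} [∀ s, MeasurableSpace (Ω s)]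

/-- `Z ∝ 𝓔_q(σ)`: every 1-Lipschitz observation `g (Z s)` of the random vector `Z s` has an
expectation and is concentrated around it, with constants `C, c` that are valid for every index
`s` of the family. -/
def LipschitzConcentrated {E : S → Type w} [∀ s, NormedAddCommGroup (E s)]
    (P : ∀ s, Measure (Ω s)) (Z : ∀ s, Ω s → E s) (q : ℝ) (σ : S → ℝ) : Prop :=
  ∃ C > 0, ∃ c > 0, ∀ s, ∀ g : E s → ℝ, LipschitzWith 1 g →
    Integrable (fun ω => g (Z s ω)) (P s) ∧
    ∀ t : ℝ, 0 < t →
      (P s).real {ω | t ≤ |g (Z s ω) - ∫ ω', g (Z s ω') ∂(P s)|}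
        ≤ C * Real.exp (-(t / (c * σ s)) ^ q)

/-- `Z ∈ Z₀ ± 𝓔_q(σ) | e^{-θ}` with concentration zone `A`: the events `A s` satisfy
`ℙ(Aᶜ) ≤ C e^{-θ/c}`, and conditionally on `A s` every linear form of norm at most one of the
random vector `Z s` is concentrated around its value at the deterministic vector `Z₀ s`.
`(P s)[|A s]` is the conditional probability `P s (· ∩ A s) / P s (A s)`. -/
def LinearlyConcentratedOn {E : S → Type w} [∀ s, NormedAddCommGroup (E s)]
    [∀ s, NormedSpace ℝ (E s)]
    (P : ∀ s, Measure (Ω s)) (A : ∀ s, Set (Ω s)) (Z : ∀ s, Ω s → E s) (Z₀ : ∀ s, E s)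
    (q : ℝ) (σ θ : S → ℝ) : Prop :=
  (∀ s, MeasurableSet (A s) ∧ P s (A s) ≠ 0 ∧ AEStronglyMeasurable (Z s) ((P s)[|A s])) ∧
  ∃ C > 0, ∃ c > 0, ∀ s,
    (P s).real (A s)ᶜ ≤ C * Real.exp (-(θ s / c)) ∧
    ∀ φ : E s →L[ℝ] ℝ, ‖φ‖ ≤ 1 → ∀ t : ℝ, 0 < t →
      ((P s)[|A s]).real {ω | t ≤ |φ (Z s ω) - φ (Z₀ s)|}
        ≤ C * Real.exp (-(t / (c * σ s)) ^ q)

end Concentration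

/-! ### The fixed points. The data are the columns `x j ∈ ℝᵖ`, `j ∈ [n]`, of a matrix `X`. -/

section FixedPoint

variable {n p : ℕ}

/-- The matrix `X = (x₁, …, xₙ)` with columns `x j`. -/
def dataMatrix (x : Fin n → EuclideanSpace ℝ (Fin p)) : Matrix (Fin p) (Fin n) ℝ :=
  Matrix.of fun a j => x j a

/-- The spectral norm `‖X Xᵀ‖`. -/
def gramNorm (x : Fin n → EuclideanSpace ℝ (Fin p)) : ℝ :=
  ‖Matrix.toEuclideanCLM (𝕜 := ℝ) (n := Fin p) (dataMatrix x * (dataMatrix x).transpose)‖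

/-- The unique solution of `y = Φ y` (and `0` if there is no unique solution). -/
def uniqueFixedPoint {E : Type*} [Zero E] (Φ : E → E) : E :=
  open Classical in if h : ∃! y, y = Φ y then h.choose else 0

/-- `y ↦ (1/n) ∑ⱼ f(xⱼᵀ y) xⱼ`. -/
def regressionMap (f : ℝ → ℝ) (x : Fin n → EuclideanSpace ℝ (Fin p))
    (y : EuclideanSpace ℝ (Fin p)) : EuclideanSpace ℝ (Fin p) :=
  (1 / (n : ℝ)) • ∑ j, f (inner ℝ (x j) y) • x j

/-- `y ↦ (1/n) ∑_{j ≠ i} f(xⱼᵀ y) xⱼ`. -/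
def leaveOneOutMap (f : ℝ → ℝ) (x : Fin n → EuclideanSpace ℝ (Fin p)) (i : Fin n)
    (y : EuclideanSpace ℝ (Fin p)) : EuclideanSpace ℝ (Fin p) :=
  (1 / (n : ℝ)) • ∑ j ∈ Finset.univ.erase i, f (inner ℝ (x j) y) • x j

/-- `y ↦ (1/n) ∑_{j ≠ i} f(xⱼᵀ y) xⱼ + (t/n) f(xᵢᵀ y) xᵢ`. -/
def bridgeMap (f : ℝ → ℝ) (x : Fin n → EuclideanSpace ℝ (Fin p)) (i : Fin n) (t : ℝ)
    (y : EuclideanSpace ℝ (Fin p)) : EuclideanSpace ℝ (Fin p) :=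
  leaveOneOutMap f x i y + (t / (n : ℝ)) • f (inner ℝ (x i) y) • x i

/-- `Y`. -/
def regressor (f : ℝ → ℝ) (x : Fin n → EuclideanSpace ℝ (Fin p)) : EuclideanSpace ℝ (Fin p) :=
  uniqueFixedPoint (regressionMap f x)

/-- `Y₋ᵢ`. -/
def leaveOneOut (f : ℝ → ℝ) (x : Fin n → EuclideanSpace ℝ (Fin p)) (i : Fin n) :
    EuclideanSpace ℝ (Fin p) :=
  uniqueFixedPoint (leaveOneOutMap f x i)

/-- `y₋ᵢ(t)`. -/
def bridge (f : ℝ → ℝ) (x : Fin n → EuclideanSpace ℝ (Fin p)) (i : Fin n) (t : ℝ) :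
    EuclideanSpace ℝ (Fin p) :=
  uniqueFixedPoint (bridgeMap f x i t)

/-- `I_p - (1/n) X D₋ᵢ Xᵀ`, where `D₋ᵢ` is diagonal with entries `f'(xⱼᵀ Y₋ᵢ)` for `j ≠ i` and
`0` for `j = i`. -/
def preResolvent (f : ℝ → ℝ) (x : Fin n → EuclideanSpace ℝ (Fin p)) (i : Fin n) :
    Matrix (Fin p) (Fin p) ℝ :=
  1 - (1 / (n : ℝ)) • (dataMatrix x *
    Matrix.diagonal (fun j => if j = i then 0 else deriv f (inner ℝ (x j) (leaveOneOut f x i))) *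
    (dataMatrix x).transpose)

/-- `Q₋ᵢ = (I_p - (1/n) X D₋ᵢ Xᵀ)⁻¹`. -/
def resolvent (f : ℝ → ℝ) (x : Fin n → EuclideanSpace ℝ (Fin p)) (i : Fin n) :
    Matrix (Fin p) (Fin p) ℝ :=
  (preResolvent f x i)⁻¹

/-- `‖Y - Y₋ᵢ - (1/n) f(xᵢᵀ Y) Q₋ᵢ xᵢ‖`. -/
def residualNorm (f : ℝ → ℝ) (x : Fin n → EuclideanSpace ℝ (Fin p)) (i : Fin n) : ℝ :=
  ‖regressor f x - leaveOneOut f x i -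
    (1 / (n : ℝ)) • f (inner ℝ (x i) (regressor f x)) •
      Matrix.toEuclideanCLM (𝕜 := ℝ) (n := Fin p) (resolvent f x i) (x i)‖

/-- `sup_{t ∈ [0,1]} |xᵢᵀ y₋ᵢ(t)|`, as an extended nonnegative real. -/
def supBridge (f : ℝ → ℝ) (x : Fin n → EuclideanSpace ℝ (Fin p)) (i : Fin n) : ENNReal :=
  ⨆ t : Set.Icc (0 : ℝ) 1, ENNReal.ofReal |inner ℝ (x i) (bridge f x i t)|

end FixedPoint

/-- `Σ = 𝔼[Z Zᵀ]`. -/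
def secondMoment {Ω : Type*} [MeasurableSpace Ω] {p : ℕ} (P : Measure Ω)
    (Z : Ω → EuclideanSpace ℝ (Fin p)) : Matrix (Fin p) (Fin p) ℝ :=
  Matrix.of fun a b => ∫ ω, Z ω a * Z ω b ∂P

/-- The event `𝓐_Y = {(lam/n) ‖X Xᵀ‖ ≤ 1 - ε}`. -/
def goodEvent {Ω : Type*} {n p : ℕ} (x : Fin n → Ω → EuclideanSpace ℝ (Fin p)) (lam ε : ℝ) :
    Set Ω :=
  {ω | lam / n * gramNorm (fun j => x j ω) ≤ 1 - ε}

end RobustRegression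

end

noncomputable section

namespace RobustRegression

/-! ### Frame bounds for the columns of the data matrix -/

section Frame

variable {n p : ℕ} (x : Fin n → EuclideanSpace ℝ (Fin p))

/-! On `goodEvent` every map $y\mapsto\frac1n\sum_j w_jf(x_j^Ty)x_j$ with $|w_j|\le1$ contracts by
the factor $1-\varepsilon$. This gives existence, uniqueness and stability of all the fixed points
(`norm_uniqueFixedPoint_sub_le`), and the same estimate bounds $Q_{-i}$ by $\varepsilon^{-1}$.
Markov's inequality gives the event probability at least $\varepsilon$, so conditioning costs only a
factor $\varepsilon^{-1}$. Its complement is exponentially rare because $\sqrt{\|XX^T\|}$ is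
1-Lipschitz in $X$ and its mean lies below the threshold by order $\sqrt n$.

$Y_{-i}$ and $Q_{-i}$ do not involve $x_i$, and replacing $x_i$ by $0$ keeps the data good. Hence
$x_i$ can be integrated with the other columns frozen (`lintegral_le_of_indepFun`,
`measure_le_of_indepFun`). As $\|Y_{-i}\|$ is bounded, $x_i^TY_{-i}$ has bounded moments, and moving
along the bridge changes $|x_i^Ty_{-i}(t)|$ by a constant factor and an additive constant
(`supBridge_le`). This bounds $M_i$.

For the residual put $R(t)=y_{-i}(t)-Y_{-i}-\frac tnf(x_i^Ty_{-i}(t))Q_{-i}x_i$. Applying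
$Q_{-i}^{-1}$ leaves only second-order Taylor remainders, so with $g=\sqrt{n/\lambda}$,
$\|R(t)\|\le\frac ag\|(x_j^T(y_{-i}(t)-Y_{-i}))_{j\ne i}\|_{\ell^4}^2$. Substituting the definition
of $R$ gives $\|R\|\le\frac{2a}gw^2+2ag\|R\|^2$, where $w=\frac Bn\|(x_j^TQ_{-i}x_i)_{j\ne
i}\|_{\ell^4}$. Continuity in $t$ and $R(0)=0$ turn this into $\|R(1)\|\le\mathrm{const}\cdot w^2/g$
(`residualNorm_le`).

With the other columns frozen, the $\ell^4$ norm is $O(\sqrt n)$-Lipschitz in $x_i$ and has mean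
$O(n^{3/4})$, so $w^2/g$ is typically $O(1/n)$. For $n\tau$ above a constant, $\mathbb
P(\|R(1)\|\ge\tau)$ on the good event is at most of order $e^{-cn^{3/2}\tau}$. The crude bound
$\|R(1)\|=O(n^{-1/2})$ restricts $\tau$ to a range where $n^{3/2}\tau$ dominates $(n\tau)^2$, which
gives the Gaussian tail at scale $1/n$ (`cond_real_residualNorm_le`). -/

lemma toEuclideanCLM_dataMatrix_diagonal (d : Fin n → ℝ) (y : EuclideanSpace ℝ (Fin p)) :
    Matrix.toEuclideanCLM (𝕜 := ℝ) (n := Fin p)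
      (dataMatrix x * Matrix.diagonal d * (dataMatrix x).transpose) y
      = ∑ j, (d j * inner ℝ (x j) y) • x j := by
  ext a
  rw [Matrix.ofLp_toEuclideanCLM, ← Matrix.mulVec_mulVec, ← Matrix.mulVec_mulVec]
  simp only [Matrix.mulVec, dotProduct, dataMatrix, Matrix.of_apply, Matrix.transpose_apply,
    Matrix.diagonal_apply, WithLp.ofLp_sum, WithLp.ofLp_smul, Finset.sum_apply, Pi.smul_apply,
    smul_eq_mul, PiLp.inner_apply, RCLike.inner_apply, conj_trivial, ite_mul, zero_mul,
    Finset.sum_ite_eq, Finset.mem_univ, if_true]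
  refine Finset.sum_congr rfl fun j _ => ?_
  rw [mul_comm]
  congr 2
  exact Finset.sum_congr rfl fun b _ => mul_comm _ _

lemma toEuclideanCLM_gram (y : EuclideanSpace ℝ (Fin p)) :
    Matrix.toEuclideanCLM (𝕜 := ℝ) (n := Fin p) (dataMatrix x * (dataMatrix x).transpose) y
      = ∑ j, inner ℝ (x j) y • x j := by
  simpa using toEuclideanCLM_dataMatrix_diagonal x (fun _ => 1) y

lemma gramNorm_nonneg : 0 ≤ gramNorm x := norm_nonneg _

lemma sum_inner_sq_le_gramNorm (y : EuclideanSpace ℝ (Fin p)) :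
    ∑ j, inner ℝ (x j) y ^ 2 ≤ gramNorm x * ‖y‖ ^ 2 := by
  have h1 : ∑ j, inner ℝ (x j) y ^ 2 = inner ℝ
      (Matrix.toEuclideanCLM (𝕜 := ℝ) (n := Fin p) (dataMatrix x * (dataMatrix x).transpose) y)
      y := by
    rw [toEuclideanCLM_gram, sum_inner]
    exact Finset.sum_congr rfl fun j _ => by rw [real_inner_smul_left, sq]
  rw [h1]
  refine (real_inner_le_norm _ _).trans ?_
  have h2 := ContinuousLinearMap.le_opNorm
    (Matrix.toEuclideanCLM (𝕜 := ℝ) (n := Fin p) (dataMatrix x * (dataMatrix x).transpose)) y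
  calc _ ≤ (gramNorm x * ‖y‖) * ‖y‖ := mul_le_mul_of_nonneg_right h2 (norm_nonneg _)
    _ = _ := by ring

variable {x}

/-- Duality: the synthesis map $a\mapsto\sum_ja_jx_j$ is the adjoint of $y\mapsto(x_j^Ty)_j$ and has
the same norm. Pair the sum with itself, use Cauchy–Schwarz and cancel $\|z\|^2$. -/
lemma norm_sum_smul_sq_le {Γ : ℝ} (hΓ : 0 ≤ Γ)
    (h : ∀ y, ∑ j, inner ℝ (x j) y ^ 2 ≤ Γ * ‖y‖ ^ 2) (a : Fin n → ℝ) :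
    ‖∑ j, a j • x j‖ ^ 2 ≤ Γ * ∑ j, a j ^ 2 := by
  set z := ∑ j, a j • x j with hz
  have h1 : ‖z‖ ^ 2 = ∑ j, a j * inner ℝ (x j) z := by
    rw [← real_inner_self_eq_norm_sq]
    nth_rewrite 1 [hz]
    rw [sum_inner]
    exact Finset.sum_congr rfl fun j _ => by rw [real_inner_smul_left]
  have h2 : (‖z‖ ^ 2) ^ 2 ≤ (∑ j, a j ^ 2) * (Γ * ‖z‖ ^ 2) := by
    rw [h1]
    refine (Finset.sum_mul_sq_le_sq_mul_sq _ _ _).trans ?_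
    rw [← h1]
    exact mul_le_mul_of_nonneg_left (h z) (Finset.sum_nonneg fun _ _ => sq_nonneg _)
  rcases (sq_nonneg ‖z‖).eq_or_lt with h0 | h0
  · rw [← h0]
    exact mul_nonneg hΓ (Finset.sum_nonneg fun _ _ => sq_nonneg _)
  · refine le_of_mul_le_mul_right ?_ h0
    calc _ = (‖z‖ ^ 2) ^ 2 := by ring
      _ ≤ _ := h2
      _ = _ := by ring

lemma gramNorm_le {Γ : ℝ} (hΓ : 0 ≤ Γ) (h : ∀ y, ∑ j, inner ℝ (x j) y ^ 2 ≤ Γ * ‖y‖ ^ 2) :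
    gramNorm x ≤ Γ := by
  refine ContinuousLinearMap.opNorm_le_bound _ hΓ fun y => ?_
  rw [toEuclideanCLM_gram]
  refine le_of_sq_le_sq ?_ (by positivity)
  calc _ ≤ Γ * ∑ j, inner ℝ (x j) y ^ 2 := norm_sum_smul_sq_le hΓ h _
    _ ≤ Γ * (Γ * ‖y‖ ^ 2) := mul_le_mul_of_nonneg_left (h y) hΓ
    _ = _ := by ring

variable (x)

lemma norm_sum_smul_sq_le_gramNorm (a : Fin n → ℝ) :
    ‖∑ j, a j • x j‖ ^ 2 ≤ gramNorm x * ∑ j, a j ^ 2 :=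
  norm_sum_smul_sq_le (gramNorm_nonneg x) (sum_inner_sq_le_gramNorm x) a

lemma norm_sq_le_gramNorm (i : Fin n) : ‖x i‖ ^ 2 ≤ gramNorm x := by
  have := norm_sum_smul_sq_le_gramNorm x (Pi.single i 1)
  simpa [Pi.single_apply, ite_smul] using this

/-- This keeps the data good when the column $x_i$ is erased, which is what allows freezing. -/
lemma gramNorm_update_zero_le (i : Fin n) :
    gramNorm (Function.update x i 0) ≤ gramNorm x := by
  refine gramNorm_le (gramNorm_nonneg x) fun y => ?_
  refine le_trans (Finset.sum_le_sum fun j _ => ?_) (sum_inner_sq_le_gramNorm x y)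
  by_cases hj : j = i
  · subst hj
    simpa using sq_nonneg _
  · simp [hj]

lemma sqrt_sum_inner_sq (y : EuclideanSpace ℝ (Fin p)) :
    √(∑ j, inner ℝ (x j) y ^ 2)
      = ‖(WithLp.toLp 2 (fun j => inner ℝ (x j) y) : EuclideanSpace ℝ (Fin n))‖ := by
  simp [EuclideanSpace.norm_eq]

/-- The largest singular value is 1-Lipschitz for the Frobenius norm. -/
lemma lipschitzWith_sqrt_gramNorm :
    LipschitzWith 1 (fun X : PiLp 2 (fun _ : Fin n => EuclideanSpace ℝ (Fin p)) =>
      √(gramNorm X.ofLp)) := by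
  refine LipschitzWith.of_le_add fun X Z => ?_
  have hd : 0 ≤ √(gramNorm Z.ofLp) + dist X Z := by positivity
  refine Real.sqrt_le_iff.2 ⟨hd, gramNorm_le (sq_nonneg _) fun y => ?_⟩
  -- Triangle inequality for $X^Ty=Z^Ty+(X-Z)^Ty$; the last term is at most the Frobenius norm of
  -- $X-Z$ times $\|y\|$.
  have key : √(∑ j, inner ℝ (X.ofLp j) y ^ 2) ≤ (√(gramNorm Z.ofLp) + dist X Z) * ‖y‖ := by
    have e : (WithLp.toLp 2 (fun j => inner ℝ (X.ofLp j) y) : EuclideanSpace ℝ (Fin n))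
        = WithLp.toLp 2 (fun j => inner ℝ (Z.ofLp j) y)
          + WithLp.toLp 2 (fun j => inner ℝ ((X - Z).ofLp j) y) := by
      ext j
      simp [inner_sub_left]
    rw [sqrt_sum_inner_sq, e, add_mul]
    refine (norm_add_le _ _).trans (add_le_add ?_ ?_)
    · rw [← sqrt_sum_inner_sq, ← Real.sqrt_sq (norm_nonneg y), ← Real.sqrt_mul (gramNorm_nonneg _)]
      exact Real.sqrt_le_sqrt (sum_inner_sq_le_gramNorm _ y)
    · rw [← sqrt_sum_inner_sq, dist_eq_norm]
      refine Real.sqrt_le_iff.2 ⟨by positivity, ?_⟩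
      rw [mul_pow, PiLp.norm_sq_eq_of_L2, Finset.sum_mul]
      refine Finset.sum_le_sum fun j _ => ?_
      rw [← mul_pow]
      exact sq_le_sq' (neg_le_of_abs_le (abs_real_inner_le_norm _ _)) (real_inner_le_norm _ _)
  rw [← mul_pow]
  exact (Real.sqrt_le_iff.1 key).2

lemma continuous_gramNorm :
    Continuous (fun x : Fin n → EuclideanSpace ℝ (Fin p) => gramNorm x) := by
  have h : Continuous (fun x : Fin n → EuclideanSpace ℝ (Fin p) => √(gramNorm x) ^ 2) :=
    ((lipschitzWith_sqrt_gramNorm (n := n) (p := p)).continuous.comp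
      (PiLp.continuous_toLp 2 _)).pow 2
  simpa only [Real.sq_sqrt (gramNorm_nonneg _)] using h

end Frame

/-! ### Weighted regression maps and their fixed points -/

section Weighted

variable {n p : ℕ}

/-- `y ↦ (1/n) ∑ⱼ wⱼ f(xⱼᵀ y) xⱼ`. -/
def weightedMap (f : ℝ → ℝ) (x : Fin n → EuclideanSpace ℝ (Fin p)) (w : Fin n → ℝ)
    (y : EuclideanSpace ℝ (Fin p)) : EuclideanSpace ℝ (Fin p) :=
  (1 / (n : ℝ)) • ∑ j, (w j * f (inner ℝ (x j) y)) • x j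

lemma regressionMap_eq (f : ℝ → ℝ) (x : Fin n → EuclideanSpace ℝ (Fin p)) :
    regressionMap f x = weightedMap f x 1 := by
  ext1 y; simp [regressionMap, weightedMap]

/-- The weight $t$ sits at the index $i$ and all other weights are $1$, so one contraction estimate
covers the three equations: $t=1$ gives $Y$ and $t=0$ gives $Y_{-i}$. -/
lemma bridgeMap_eq (f : ℝ → ℝ) (x : Fin n → EuclideanSpace ℝ (Fin p)) (i : Fin n) (t : ℝ) :
    bridgeMap f x i t = weightedMap f x (Function.update 1 i t) := by
  ext1 y
  rw [bridgeMap, leaveOneOutMap, weightedMap,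
    ← Finset.sum_erase_add _ _ (Finset.mem_univ i), smul_add]
  congr 1
  · congr 1
    refine Finset.sum_congr rfl fun j hj => ?_
    rw [Function.update_of_ne (Finset.ne_of_mem_erase hj)]
    simp
  · simp only [Function.update_self, smul_smul]
    congr 1
    ring

lemma leaveOneOutMap_eq_bridgeMap (f : ℝ → ℝ) (x : Fin n → EuclideanSpace ℝ (Fin p)) (i : Fin n) :
    leaveOneOutMap f x i = bridgeMap f x i 0 := by
  ext1 y; simp [bridgeMap]

lemma regressionMap_eq_bridgeMap (f : ℝ → ℝ) (x : Fin n → EuclideanSpace ℝ (Fin p)) (i : Fin n) :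
    regressionMap f x = bridgeMap f x i 1 := by
  rw [bridgeMap_eq, regressionMap_eq]
  congr 1
  exact (Function.update_eq_self i (1 : Fin n → ℝ)).symm

lemma leaveOneOut_eq_bridge (f : ℝ → ℝ) (x : Fin n → EuclideanSpace ℝ (Fin p)) (i : Fin n) :
    leaveOneOut f x i = bridge f x i 0 := by
  rw [leaveOneOut, bridge, leaveOneOutMap_eq_bridgeMap]

lemma regressor_eq_bridge (f : ℝ → ℝ) (x : Fin n → EuclideanSpace ℝ (Fin p)) (i : Fin n) :
    regressor f x = bridge f x i 1 := by
  rw [regressor, bridge, regressionMap_eq_bridgeMap f x i]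

lemma leaveOneOutMap_update (f : ℝ → ℝ) (x : Fin n → EuclideanSpace ℝ (Fin p)) (i : Fin n) :
    leaveOneOutMap f (Function.update x i 0) i = leaveOneOutMap f x i := by
  ext1 y
  rw [leaveOneOutMap, leaveOneOutMap]
  congr 1
  refine Finset.sum_congr rfl fun j hj => ?_
  rw [Function.update_of_ne (Finset.ne_of_mem_erase hj)]

/-- Needs no good data: even the default value depends only on the map, which does not see $x_i$. -/
lemma leaveOneOut_update (f : ℝ → ℝ) (x : Fin n → EuclideanSpace ℝ (Fin p)) (i : Fin n) :
    leaveOneOut f (Function.update x i 0) i = leaveOneOut f x i := by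
  rw [leaveOneOut, leaveOneOutMap_update, leaveOneOut]

lemma uniqueFixedPoint_spec {E : Type*} [Zero E] {Φ : E → E} (h : ∃! y, y = Φ y) :
    uniqueFixedPoint Φ = Φ (uniqueFixedPoint Φ) := by
  rw [uniqueFixedPoint, dif_pos h]
  exact h.choose_spec.1

lemma uniqueFixedPoint_eq {E : Type*} [Zero E] {Φ : E → E} (h : ∃! y, y = Φ y) {y : E}
    (hy : y = Φ y) : uniqueFixedPoint Φ = y :=
  h.unique (uniqueFixedPoint_spec h) hy

lemma norm_average_le {x : Fin n → EuclideanSpace ℝ (Fin p)} {lam : ℝ} (hlam : 0 ≤ lam)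
    {a : Fin n → ℝ} {v : EuclideanSpace ℝ (Fin p)} (ha : ∀ j, |a j| ≤ lam * |inner ℝ (x j) v|) :
    ‖(1 / (n : ℝ)) • ∑ j, a j • x j‖ ≤ lam / n * gramNorm x * ‖v‖ := by
  have hg := gramNorm_nonneg x
  have h : ‖∑ j, a j • x j‖ ≤ lam * gramNorm x * ‖v‖ := by
    refine le_of_sq_le_sq ?_ (by positivity)
    calc _ ≤ gramNorm x * ∑ j, a j ^ 2 := norm_sum_smul_sq_le_gramNorm x a
      _ ≤ gramNorm x * ∑ j, lam ^ 2 * inner ℝ (x j) v ^ 2 := by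
        refine mul_le_mul_of_nonneg_left (Finset.sum_le_sum fun j _ => ?_) hg
        rw [← mul_pow, sq_le_sq, abs_mul, abs_of_nonneg hlam]
        exact ha j
      _ ≤ gramNorm x * (lam ^ 2 * (gramNorm x * ‖v‖ ^ 2)) := by
        rw [← Finset.mul_sum]
        gcongr
        exact sum_inner_sq_le_gramNorm x v
      _ = _ := by ring
  rw [norm_smul, Real.norm_of_nonneg (by positivity)]
  calc _ ≤ 1 / (n : ℝ) * (lam * gramNorm x * ‖v‖) := by gcongr
    _ = _ := by ring

lemma abs_sub_le_of_deriv_le {f : ℝ → ℝ} (hf : Differentiable ℝ f) {lam : ℝ}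
    (hflam : ∀ u, |deriv f u| ≤ lam) (u v : ℝ) : |f u - f v| ≤ lam * |u - v| :=
  Convex.norm_image_sub_le_of_norm_deriv_le (fun x _ => hf x) (fun x _ => hflam x) convex_univ
    (Set.mem_univ v) (Set.mem_univ u)

variable {f : ℝ → ℝ} {lam ε : ℝ} {x : Fin n → EuclideanSpace ℝ (Fin p)} {w : Fin n → ℝ}

lemma norm_weightedMap_sub_le (hlam : 0 ≤ lam) (hfl : ∀ u v, |f u - f v| ≤ lam * |u - v|)
    (hx : lam / n * gramNorm x ≤ 1 - ε) (hw : ∀ j, |w j| ≤ 1)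
    (y z : EuclideanSpace ℝ (Fin p)) :
    ‖weightedMap f x w y - weightedMap f x w z‖ ≤ (1 - ε) * ‖y - z‖ := by
  rw [weightedMap, weightedMap, ← smul_sub, ← Finset.sum_sub_distrib]
  simp_rw [← sub_smul]
  refine (norm_average_le (v := y - z) hlam fun j => ?_).trans
    (mul_le_mul_of_nonneg_right hx (norm_nonneg _))
  rw [← mul_sub, abs_mul, inner_sub_right]
  calc _ ≤ 1 * (lam * |inner ℝ (x j) y - inner ℝ (x j) z|) := by
        gcongr
        · exact hw j
        · exact hfl _ _
    _ = _ := one_mul _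

lemma contractingWith_weightedMap (hε : 0 < ε) (hlam : 0 ≤ lam)
    (hfl : ∀ u v, |f u - f v| ≤ lam * |u - v|)
    (hx : lam / n * gramNorm x ≤ 1 - ε) (hw : ∀ j, |w j| ≤ 1) :
    ContractingWith (1 - ε).toNNReal (weightedMap f x w) := by
  have h0 : 0 ≤ 1 - ε := by
    have := gramNorm_nonneg x
    exact le_trans (by positivity) hx
  refine ⟨by rw [Real.toNNReal_lt_one]; linarith, LipschitzWith.of_dist_le_mul fun y z => ?_⟩
  rw [dist_eq_norm, dist_eq_norm, Real.coe_toNNReal _ h0]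
  exact norm_weightedMap_sub_le hlam hfl hx hw y z

lemma existsUnique_weightedMap (hε : 0 < ε) (hlam : 0 ≤ lam)
    (hfl : ∀ u v, |f u - f v| ≤ lam * |u - v|)
    (hx : lam / n * gramNorm x ≤ 1 - ε) (hw : ∀ j, |w j| ≤ 1) :
    ∃! y, y = weightedMap f x w y := by
  have h := contractingWith_weightedMap hε hlam hfl hx hw
  exact ⟨h.fixedPoint, h.fixedPoint_isFixedPt.symm, fun y hy => h.fixedPoint_unique hy.symm⟩

lemma tendsto_iterate_weightedMap (hε : 0 < ε) (hlam : 0 ≤ lam)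
    (hfl : ∀ u v, |f u - f v| ≤ lam * |u - v|)
    (hx : lam / n * gramNorm x ≤ 1 - ε) (hw : ∀ j, |w j| ≤ 1) :
    Filter.Tendsto (fun k => (weightedMap f x w)^[k] 0) Filter.atTop
      (nhds (uniqueFixedPoint (weightedMap f x w))) := by
  have h := contractingWith_weightedMap hε hlam hfl hx hw
  rw [uniqueFixedPoint_eq (existsUnique_weightedMap hε hlam hfl hx hw)
    h.fixedPoint_isFixedPt.symm]
  exact h.tendsto_iterate_fixedPoint 0

/-- The a posteriori estimate for a contraction: $\|y-z\|\le(1-\varepsilon)\|y-z\|+\|\Phi z-z\|$.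
Every later comparison of fixed points is an instance, for a suitable $z$. -/
lemma norm_uniqueFixedPoint_sub_le (hε : 0 < ε) (hlam : 0 ≤ lam)
    (hfl : ∀ u v, |f u - f v| ≤ lam * |u - v|)
    (hx : lam / n * gramNorm x ≤ 1 - ε) (hw : ∀ j, |w j| ≤ 1) (z : EuclideanSpace ℝ (Fin p)) :
    ‖uniqueFixedPoint (weightedMap f x w) - z‖ ≤ ε⁻¹ * ‖weightedMap f x w z - z‖ := by
  set y := uniqueFixedPoint (weightedMap f x w)
  have hy : y = weightedMap f x w y :=
    uniqueFixedPoint_spec (existsUnique_weightedMap hε hlam hfl hx hw)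
  have h1 := norm_weightedMap_sub_le hlam hfl hx hw y z
  rw [← hy] at h1
  have h2 : ‖y - z‖ ≤ ‖y - weightedMap f x w z‖ + ‖weightedMap f x w z - z‖ :=
    norm_sub_le_norm_sub_add_norm_sub _ _ _
  rw [inv_mul_eq_div, le_div_iff₀ hε]
  linarith

lemma abs_update_one_le {t : ℝ} (ht : t ∈ Set.Icc (0 : ℝ) 1) (i j : Fin n) :
    |Function.update (1 : Fin n → ℝ) i t j| ≤ 1 := by
  by_cases h : j = i
  · subst h
    rw [Function.update_self, abs_le]
    exact ⟨by linarith [ht.1], ht.2⟩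
  · simp [h]

lemma existsUnique_bridgeMap (hε : 0 < ε) (hlam : 0 ≤ lam)
    (hfl : ∀ u v, |f u - f v| ≤ lam * |u - v|)
    (hx : lam / n * gramNorm x ≤ 1 - ε) (i : Fin n) {t : ℝ} (ht : t ∈ Set.Icc (0 : ℝ) 1) :
    ∃! y, y = bridgeMap f x i t y := by
  rw [bridgeMap_eq]
  exact existsUnique_weightedMap hε hlam hfl hx (abs_update_one_le ht i)

lemma norm_bridge_sub_le (hε : 0 < ε) (hlam : 0 ≤ lam)
    (hfl : ∀ u v, |f u - f v| ≤ lam * |u - v|)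
    (hx : lam / n * gramNorm x ≤ 1 - ε) (i : Fin n) {t : ℝ} (ht : t ∈ Set.Icc (0 : ℝ) 1)
    (z : EuclideanSpace ℝ (Fin p)) :
    ‖bridge f x i t - z‖ ≤ ε⁻¹ * ‖bridgeMap f x i t z - z‖ := by
  rw [bridge, bridgeMap_eq]
  exact norm_uniqueFixedPoint_sub_le hε hlam hfl hx (abs_update_one_le ht i) z

/-- The defect of $y_{-i}(s)$ in the equation with parameter $t$ is exactly
$\frac{t-s}nf(x_i^Ty_{-i}(s))x_i$. -/
lemma norm_bridge_sub_bridge_le (hε : 0 < ε) (hlam : 0 ≤ lam)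
    (hfl : ∀ u v, |f u - f v| ≤ lam * |u - v|)
    (hx : lam / n * gramNorm x ≤ 1 - ε) (i : Fin n) {s t : ℝ} (hs : s ∈ Set.Icc (0 : ℝ) 1)
    (ht : t ∈ Set.Icc (0 : ℝ) 1) :
    ‖bridge f x i t - bridge f x i s‖
      ≤ ε⁻¹ * (|t - s| / n * (|f (inner ℝ (x i) (bridge f x i s))| * ‖x i‖)) := by
  refine (norm_bridge_sub_le hε hlam hfl hx i ht _).trans (le_of_eq ?_)
  have hs' : bridge f x i s = bridgeMap f x i s (bridge f x i s) :=
    uniqueFixedPoint_spec (existsUnique_bridgeMap hε hlam hfl hx i hs)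
  have : bridgeMap f x i t (bridge f x i s) - bridge f x i s
      = ((t - s) / n) • f (inner ℝ (x i) (bridge f x i s)) • x i := by
    nth_rewrite 2 [hs']
    rw [bridgeMap, bridgeMap, add_sub_add_left_eq_sub, ← sub_smul, sub_div]
  rw [this, norm_smul, norm_smul, Real.norm_eq_abs, Real.norm_eq_abs, abs_div, Nat.abs_cast]

lemma continuousOn_bridge (hε : 0 < ε) (hlam : 0 ≤ lam)
    (hfl : ∀ u v, |f u - f v| ≤ lam * |u - v|)
    (hx : lam / n * gramNorm x ≤ 1 - ε) (i : Fin n) :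
    ContinuousOn (bridge f x i) (Set.Icc 0 1) := by
  intro s hs
  rw [ContinuousWithinAt, tendsto_iff_norm_sub_tendsto_zero]
  refine squeeze_zero' (Filter.Eventually.of_forall fun _ => norm_nonneg _)
    (g := fun t => ε⁻¹ * (|t - s| / n * (|f (inner ℝ (x i) (bridge f x i s))| * ‖x i‖)))
    (eventually_nhdsWithin_of_forall fun t ht =>
      norm_bridge_sub_bridge_le hε hlam hfl hx i hs ht) ?_
  have : Continuous fun t : ℝ =>
      ε⁻¹ * (|t - s| / n * (|f (inner ℝ (x i) (bridge f x i s))| * ‖x i‖)) := by fun_prop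
  have h := (this.tendsto s).mono_left (nhdsWithin_le_nhds (s := Set.Icc (0 : ℝ) 1))
  simpa using h

lemma gramNorm_le_div (hn : 0 < n) (hε : 0 < ε) (hlam : 0 < lam)
    (hx : lam / n * gramNorm x ≤ 1 - ε) : gramNorm x ≤ n / lam := by
  have hn' : (0 : ℝ) < n := by exact_mod_cast hn
  rw [div_mul_eq_mul_div, div_le_iff₀ hn'] at hx
  rw [le_div_iff₀ hlam]
  nlinarith

lemma norm_leaveOneOut_le (hn : 0 < n) (hε : 0 < ε) (hlam : 0 < lam)
    (hfl : ∀ u v, |f u - f v| ≤ lam * |u - v|)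
    (hx : lam / n * gramNorm x ≤ 1 - ε) (i : Fin n) :
    ‖leaveOneOut f x i‖ ≤ ε⁻¹ * (|f 0| * √lam⁻¹) := by
  have h := norm_bridge_sub_le hε hlam.le hfl hx i (t := 0) ⟨le_rfl, zero_le_one⟩ 0
  rw [← leaveOneOut_eq_bridge, sub_zero, sub_zero] at h
  refine h.trans (mul_le_mul_of_nonneg_left ?_ (by positivity))
  have hn' : (0 : ℝ) < n := by exact_mod_cast hn
  rw [bridgeMap_eq, weightedMap, norm_smul, Real.norm_of_nonneg (by positivity), one_div,
    inv_mul_le_iff₀ hn']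
  refine le_of_sq_le_sq ((norm_sum_smul_sq_le_gramNorm x _).trans ?_) (by positivity)
  have h1 : ∑ j, (Function.update (1 : Fin n → ℝ) i 0 j * f (inner ℝ (x j) 0)) ^ 2
      ≤ ∑ j : Fin n, |f 0| ^ 2 := by
    refine Finset.sum_le_sum fun j _ => ?_
    rw [inner_zero_right, sq_le_sq, abs_mul, abs_abs]
    exact mul_le_of_le_one_left (abs_nonneg _)
      (abs_update_one_le ⟨le_rfl, zero_le_one⟩ i j)
  rw [Finset.sum_const, Finset.card_univ, Fintype.card_fin, nsmul_eq_mul] at h1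
  calc _ ≤ (n / lam) * (n * |f 0| ^ 2) :=
        mul_le_mul (gramNorm_le_div hn hε hlam hx) h1
          (Finset.sum_nonneg fun _ _ => sq_nonneg _) (by positivity)
    _ = _ := by
        rw [mul_pow, mul_pow, Real.sq_sqrt (by positivity)]
        ring

end Weighted

/-! ### The resolvent -/

section Resolvent

variable {n p : ℕ}

/-- `I_p - (1/n) ∑_{j ≠ i} f'(xⱼᵀ y) xⱼ xⱼᵀ`. -/
def preResolventAt (f : ℝ → ℝ) (x : Fin n → EuclideanSpace ℝ (Fin p)) (i : Fin n)
    (y : EuclideanSpace ℝ (Fin p)) : Matrix (Fin p) (Fin p) ℝ :=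
  1 - (1 / (n : ℝ)) • (dataMatrix x *
    Matrix.diagonal (fun j => if j = i then 0 else deriv f (inner ℝ (x j) y)) *
    (dataMatrix x).transpose)

lemma toEuclideanCLM_preResolvent (f : ℝ → ℝ) (x : Fin n → EuclideanSpace ℝ (Fin p)) (i : Fin n)
    (v : EuclideanSpace ℝ (Fin p)) :
    Matrix.toEuclideanCLM (𝕜 := ℝ) (n := Fin p) (preResolvent f x i) v
      = v - (1 / (n : ℝ)) • ∑ j,
        ((if j = i then 0 else deriv f (inner ℝ (x j) (leaveOneOut f x i))) * inner ℝ (x j) v)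
          • x j := by
  rw [preResolvent, map_sub, map_smul, map_one, ← toEuclideanCLM_dataMatrix_diagonal]
  rfl

lemma preResolvent_update (f : ℝ → ℝ) (x : Fin n → EuclideanSpace ℝ (Fin p)) (i : Fin n) :
    preResolvent f (Function.update x i 0) i = preResolvent f x i := by
  refine EquivLike.injective (Matrix.toEuclideanCLM (𝕜 := ℝ) (n := Fin p)) ?_
  ext1 v
  rw [toEuclideanCLM_preResolvent, toEuclideanCLM_preResolvent, leaveOneOut_update]
  congr 2
  refine Finset.sum_congr rfl fun j _ => ?_
  by_cases hj : j = i
  · simp [hj]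
  · rw [Function.update_of_ne hj]

lemma resolvent_update (f : ℝ → ℝ) (x : Fin n → EuclideanSpace ℝ (Fin p)) (i : Fin n) :
    resolvent f (Function.update x i 0) i = resolvent f x i := by
  rw [resolvent, preResolvent_update, resolvent]

variable {f : ℝ → ℝ} {lam ε : ℝ} {x : Fin n → EuclideanSpace ℝ (Fin p)}

lemma norm_le_norm_preResolvent (hlam : 0 ≤ lam) (hflam : ∀ u, |deriv f u| ≤ lam)
    (hx : lam / n * gramNorm x ≤ 1 - ε) (i : Fin n) (v : EuclideanSpace ℝ (Fin p)) :
    ε * ‖v‖ ≤ ‖Matrix.toEuclideanCLM (𝕜 := ℝ) (n := Fin p) (preResolvent f x i) v‖ := by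
  rw [toEuclideanCLM_preResolvent]
  set z := (1 / (n : ℝ)) • ∑ j,
        ((if j = i then 0 else deriv f (inner ℝ (x j) (leaveOneOut f x i))) * inner ℝ (x j) v)
          • x j with hz
  have h : ‖z‖ ≤ (1 - ε) * ‖v‖ := by
    refine (norm_average_le (v := v) hlam fun j => ?_).trans
      (mul_le_mul_of_nonneg_right hx (norm_nonneg _))
    rw [abs_mul]
    refine mul_le_mul_of_nonneg_right ?_ (abs_nonneg _)
    split_ifs
    · simpa using hlam
    · exact hflam _
  have := norm_sub_norm_le v z
  linarith

/-- The lower bound $\varepsilon\|v\|\le\|Mv\|$ makes the square matrix $M$ injective. -/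
lemma isUnit_preResolvent (hε : 0 < ε) (hlam : 0 ≤ lam) (hflam : ∀ u, |deriv f u| ≤ lam)
    (hx : lam / n * gramNorm x ≤ 1 - ε) (i : Fin n) : IsUnit (preResolvent f x i) := by
  rw [← Matrix.mulVec_injective_iff_isUnit]
  intro v v' hvv
  have h := norm_le_norm_preResolvent (f := f) hlam hflam hx i
    (WithLp.toLp 2 v - WithLp.toLp 2 v')
  rw [map_sub, Matrix.toEuclideanCLM_toLp, Matrix.toEuclideanCLM_toLp] at h
  rw [hvv, sub_self, norm_zero] at h
  have h0 : ‖WithLp.toLp 2 v - WithLp.toLp 2 v'‖ ≤ 0 := by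
    by_contra hc
    push Not at hc
    nlinarith
  exact WithLp.toLp_injective 2 (sub_eq_zero.1 (norm_le_zero_iff.1 h0))

lemma preResolvent_resolvent_apply (hε : 0 < ε) (hlam : 0 ≤ lam)
    (hflam : ∀ u, |deriv f u| ≤ lam)
    (hx : lam / n * gramNorm x ≤ 1 - ε) (i : Fin n) (v : EuclideanSpace ℝ (Fin p)) :
    Matrix.toEuclideanCLM (𝕜 := ℝ) (n := Fin p) (preResolvent f x i)
      (Matrix.toEuclideanCLM (𝕜 := ℝ) (n := Fin p) (resolvent f x i) v) = v := by
  have h := isUnit_preResolvent hε hlam hflam hx i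
  rw [← mul_apply_eq_comp, ← map_mul, resolvent,
    Matrix.mul_nonsing_inv _ ((Matrix.isUnit_iff_isUnit_det _).1 h), map_one]
  rfl

lemma norm_resolvent_le (hε : 0 < ε) (hlam : 0 ≤ lam)
    (hflam : ∀ u, |deriv f u| ≤ lam)
    (hx : lam / n * gramNorm x ≤ 1 - ε) (i : Fin n) (v : EuclideanSpace ℝ (Fin p)) :
    ‖Matrix.toEuclideanCLM (𝕜 := ℝ) (n := Fin p) (resolvent f x i) v‖ ≤ ε⁻¹ * ‖v‖ := by
  have h := norm_le_norm_preResolvent (f := f) hlam hflam hx i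
    (Matrix.toEuclideanCLM (𝕜 := ℝ) (n := Fin p) (resolvent f x i) v)
  rw [preResolvent_resolvent_apply hε hlam hflam hx] at h
  rwa [inv_mul_eq_div, le_div_iff₀' hε]

end Resolvent

/-! ### Measurability -/

section Measurability

variable {n p : ℕ}

/-- The data sets on which all the fixed-point equations are contractions. -/
def goodData (n p : ℕ) (lam ε : ℝ) : Set (Fin n → EuclideanSpace ℝ (Fin p)) :=
  {x | lam / n * gramNorm x ≤ 1 - ε}

lemma measurableSet_goodData (lam ε : ℝ) : MeasurableSet (goodData n p lam ε) :=
  (isClosed_le (continuous_const.mul continuous_gramNorm) continuous_const).measurableSet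

lemma update_mem_goodData {lam ε : ℝ} (hlam : 0 ≤ lam) {x : Fin n → EuclideanSpace ℝ (Fin p)}
    (hx : x ∈ goodData n p lam ε) (i : Fin n) : Function.update x i 0 ∈ goodData n p lam ε :=
  le_trans (mul_le_mul_of_nonneg_left (gramNorm_update_zero_le x i) (by positivity)) hx

variable {f : ℝ → ℝ} {lam ε : ℝ}

lemma continuous_weightedMap_iterate (hf : Continuous f) (w : Fin n → ℝ) (k : ℕ) :
    Continuous fun x : Fin n → EuclideanSpace ℝ (Fin p) => (weightedMap f x w)^[k] 0 := by
  induction k with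
  | zero => simpa using continuous_const
  | succ k ih =>
    simp_rw [Function.iterate_succ_apply']
    unfold weightedMap at ih ⊢
    fun_prop

/-- On good data the fixed point is the limit of the Picard iterates started at $0$, each continuous
in the data. The indicator discards the data where convergence is not known. -/
lemma measurable_indicator_bridge (hf : Continuous f) (hε : 0 < ε) (hlam : 0 ≤ lam)
    (hfl : ∀ u v, |f u - f v| ≤ lam * |u - v|) (i : Fin n) {t : ℝ} (ht : t ∈ Set.Icc (0 : ℝ) 1) :
    Measurable ((goodData n p lam ε).indicator fun x => bridge f x i t) := by
  refine measurable_of_tendsto_metrizable (f := fun k => (goodData n p lam ε).indicator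
    fun x => (weightedMap f x (Function.update 1 i t))^[k] 0)
    (fun k => (continuous_weightedMap_iterate hf _ k).measurable.indicator
      (measurableSet_goodData lam ε)) ?_
  rw [tendsto_pi_nhds]
  intro x
  by_cases hx : x ∈ goodData n p lam ε
  · simp only [Set.indicator_of_mem hx]
    rw [bridge, bridgeMap_eq]
    exact tendsto_iterate_weightedMap hε hlam hfl hx (abs_update_one_le ht i)
  · simp only [Set.indicator_of_notMem hx]
    exact tendsto_const_nhds

lemma measurable_indicator_leaveOneOut (hf : Continuous f) (hε : 0 < ε) (hlam : 0 ≤ lam)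
    (hfl : ∀ u v, |f u - f v| ≤ lam * |u - v|) (i : Fin n) :
    Measurable ((goodData n p lam ε).indicator fun x => leaveOneOut f x i) := by
  simp_rw [leaveOneOut_eq_bridge]
  exact measurable_indicator_bridge hf hε hlam hfl i ⟨le_rfl, zero_le_one⟩

lemma measurable_indicator_supBridge (hf : Continuous f) (hε : 0 < ε) (hlam : 0 ≤ lam)
    (hfl : ∀ u v, |f u - f v| ≤ lam * |u - v|) (i : Fin n) :
    Measurable ((goodData n p lam ε).indicator fun x => supBridge f x i) := by
  -- Continuity of the bridge in $t$ reduces the uncountable supremum to a countable one.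
  obtain ⟨s, hs, hd⟩ := TopologicalSpace.exists_countable_dense (Set.Icc (0 : ℝ) 1)
  have : Countable s := hs.to_subtype
  have e : (goodData n p lam ε).indicator (fun x => supBridge f x i) =
      (goodData n p lam ε).indicator (fun x => ⨆ t : s, ENNReal.ofReal |inner ℝ (x i)
        ((goodData n p lam ε).indicator (fun x => bridge f x i t) x)|) := by
    ext x
    by_cases hx : x ∈ goodData n p lam ε
    · simp only [Set.indicator_of_mem hx, supBridge]
      have hc : Continuous fun t : Set.Icc (0 : ℝ) 1 =>
          ENNReal.ofReal |inner ℝ (x i) (bridge f x i t)| := by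
        have := continuousOn_iff_continuous_domRestrict.1 (continuousOn_bridge hε hlam hfl hx i)
        exact ENNReal.continuous_ofReal.comp
          (continuous_const.inner this).abs
      exact (hd.ciSup' hc).symm
    · simp only [Set.indicator_of_notMem hx]
  rw [e]
  refine Measurable.indicator (Measurable.iSup fun t => ?_) (measurableSet_goodData lam ε)
  have := measurable_indicator_bridge (p := p) hf hε hlam hfl i t.1.2
  simp_rw [← Real.norm_eq_abs]
  exact ENNReal.measurable_ofReal.comp (((measurable_pi_apply i).inner this).norm)

lemma continuous_dataMatrix :
    Continuous (fun x : Fin n → EuclideanSpace ℝ (Fin p) => dataMatrix x) := by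
  refine continuous_matrix fun a j => ?_
  simp only [dataMatrix, Matrix.of_apply]
  fun_prop

lemma continuous_preResolventAt (hf' : Continuous (deriv f)) (i : Fin n) :
    Continuous fun q : (Fin n → EuclideanSpace ℝ (Fin p)) × EuclideanSpace ℝ (Fin p) =>
      preResolventAt f q.1 i q.2 := by
  unfold preResolventAt
  have h1 := (continuous_dataMatrix (n := n) (p := p)).comp
    (continuous_fst (Y := EuclideanSpace ℝ (Fin p)))
  have h2 : Continuous fun q : (Fin n → EuclideanSpace ℝ (Fin p)) × EuclideanSpace ℝ (Fin p) =>
      Matrix.diagonal (fun j => if j = i then 0 else deriv f (inner ℝ (q.1 j) q.2)) := by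
    refine Continuous.matrix_diagonal (continuous_pi fun j => ?_)
    split_ifs
    · exact continuous_const
    · fun_prop
  have h3 := (h1.matrix_mul h2).matrix_mul h1.matrix_transpose
  exact continuous_const.sub (h3.const_smul (1 / (n : ℝ)))

/-- Cramer's formula: the adjugate is continuous and the inverse of the determinant is measurable,
including its default value $0$. -/
lemma measurable_preResolventAt_inv_apply (hf' : Continuous (deriv f)) (i : Fin n) :
    Measurable fun q : ((Fin n → EuclideanSpace ℝ (Fin p)) × EuclideanSpace ℝ (Fin p)) ×
        EuclideanSpace ℝ (Fin p) =>
      Matrix.toEuclideanCLM (𝕜 := ℝ) (n := Fin p) (preResolventAt f q.1.1 i q.1.2)⁻¹ q.2 := by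
  have hM := (continuous_preResolventAt (p := p) hf' i).comp
    (continuous_fst (Y := EuclideanSpace ℝ (Fin p)))
  have h1 : Measurable fun q : ((Fin n → EuclideanSpace ℝ (Fin p)) × EuclideanSpace ℝ (Fin p)) ×
        EuclideanSpace ℝ (Fin p) => (preResolventAt f q.1.1 i q.1.2).det⁻¹ :=
    (hM.matrix_det).measurable.inv
  have h2 : Continuous fun q : ((Fin n → EuclideanSpace ℝ (Fin p)) × EuclideanSpace ℝ (Fin p)) ×
        EuclideanSpace ℝ (Fin p) =>
      Matrix.toEuclideanCLM (𝕜 := ℝ) (n := Fin p) (preResolventAt f q.1.1 i q.1.2).adjugate q.2 := by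
    have : Continuous fun q : ((Fin n → EuclideanSpace ℝ (Fin p)) × EuclideanSpace ℝ (Fin p)) ×
        EuclideanSpace ℝ (Fin p) => WithLp.toLp 2
          ((preResolventAt f q.1.1 i q.1.2).adjugate.mulVec q.2.ofLp) :=
      (PiLp.continuous_toLp 2 _).comp (hM.matrix_adjugate.matrix_mulVec
        ((PiLp.continuous_ofLp 2 _).comp continuous_snd))
    exact this
  convert h1.smul h2.measurable using 1
  ext1 q
  rw [Matrix.inv_def, map_smul, Ring.inverse_eq_inv']
  rfl

/-- On good data the resolvent is a measurable function of the data. -/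
lemma measurable_resolvent_apply (hf : Continuous f) (hf' : Continuous (deriv f)) (hε : 0 < ε)
    (hlam : 0 ≤ lam) (hfl : ∀ u v, |f u - f v| ≤ lam * |u - v|) (i : Fin n) :
    Measurable fun q : (Fin n → EuclideanSpace ℝ (Fin p)) × EuclideanSpace ℝ (Fin p) =>
      (goodData n p lam ε).indicator (fun x =>
        Matrix.toEuclideanCLM (𝕜 := ℝ) (n := Fin p) (resolvent f x i) q.2) q.1 := by
  have h1 := measurable_indicator_leaveOneOut (p := p) hf hε hlam hfl i
  have h2 : Measurable fun q : (Fin n → EuclideanSpace ℝ (Fin p)) × EuclideanSpace ℝ (Fin p) =>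
      ((q.1, (goodData n p lam ε).indicator (fun x => leaveOneOut f x i) q.1), q.2) := by
    fun_prop
  have h3 := ((measurable_preResolventAt_inv_apply (p := p) hf' i).comp h2).indicator
    (measurable_fst (measurableSet_goodData (n := n) (p := p) lam ε))
  convert h3 using 1
  ext1 q
  by_cases hq : q.1 ∈ goodData n p lam ε
  · rw [Set.indicator_of_mem hq, Set.indicator_of_mem (by exact hq)]
    simp only [Function.comp_apply, Set.indicator_of_mem hq]
    rfl
  · rw [Set.indicator_of_notMem hq, Set.indicator_of_notMem (by exact hq)]

lemma measurable_indicator_residualNorm (hf : Continuous f) (hf' : Continuous (deriv f))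
    (hε : 0 < ε) (hlam : 0 ≤ lam) (hfl : ∀ u v, |f u - f v| ≤ lam * |u - v|) (i : Fin n) :
    Measurable ((goodData n p lam ε).indicator fun x => residualNorm f x i) := by
  have h1 := measurable_indicator_leaveOneOut (p := p) hf hε hlam hfl i
  have h2 := measurable_indicator_bridge (p := p) hf hε hlam hfl i (t := 1) ⟨zero_le_one, le_rfl⟩
  have h3 := (measurable_resolvent_apply (p := p) hf hf' hε hlam hfl i).comp
    (measurable_id.prodMk (measurable_pi_apply i))
  have h4 : Measurable fun x : Fin n → EuclideanSpace ℝ (Fin p) =>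
      f (inner ℝ (x i) ((goodData n p lam ε).indicator (fun x => bridge f x i 1) x)) :=
    hf.measurable.comp ((measurable_pi_apply i).inner h2)
  have h5 := (((h2.sub h1).sub ((h4.smul h3).const_smul (1 / (n : ℝ)))).norm).indicator
    (measurableSet_goodData lam ε)
  convert h5 using 1
  ext1 x
  by_cases hx : x ∈ goodData n p lam ε
  · simp [hx, residualNorm, regressor_eq_bridge f x i]
  · simp [hx]

end Measurability

/-! ### Moments of Lipschitz observations -/

section Moments

variable {Ω : Type*} [MeasurableSpace Ω]

/-- The Lipschitz concentration of a single random vector, with explicit constants. -/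
def ConcentratedWith {E : Type*} [NormedAddCommGroup E] (P : Measure Ω) (Z : Ω → E) (C c : ℝ) :
    Prop :=
  ∀ g : E → ℝ, LipschitzWith 1 g →
    Integrable (fun ω => g (Z ω)) P ∧
    ∀ t : ℝ, 0 < t →
      P.real {ω | t ≤ |g (Z ω) - ∫ ω', g (Z ω') ∂P|} ≤ C * Real.exp (-(t / c) ^ 2)

variable {E : Type*} [NormedAddCommGroup E] {P : Measure Ω} {Z : Ω → E} {C c : ℝ}

lemma ConcentratedWith.comp {F : Type*} [NormedAddCommGroup F] (h : ConcentratedWith P Z C c)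
    {φ : E → F} (hφ : LipschitzWith 1 φ) : ConcentratedWith P (fun ω => φ (Z ω)) C c :=
  fun g hg => by simpa using h (g ∘ φ) (by simpa using hg.comp hφ)

lemma ConcentratedWith.of_lipschitzWith (h : ConcentratedWith P Z C c) {g : E → ℝ} {K : NNReal}
    (hK : 0 < K) (hg : LipschitzWith K g) :
    Integrable (fun ω => g (Z ω)) P ∧
    ∀ t : ℝ, 0 < t →
      P.real {ω | K * t ≤ |g (Z ω) - ∫ ω', g (Z ω') ∂P|} ≤ C * Real.exp (-(t / c) ^ 2) := by
  have hK' : (0 : ℝ) < K := hK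
  have hg' : LipschitzWith 1 (fun v => (K : ℝ)⁻¹ * g v) := by
    refine LipschitzWith.of_dist_le_mul fun u v => ?_
    rw [Real.dist_eq, ← mul_sub, abs_mul, abs_of_pos (inv_pos.2 hK'), ← Real.dist_eq,
      inv_mul_le_iff₀ hK', NNReal.coe_one, one_mul]
    exact hg.dist_le_mul u v
  obtain ⟨h1, h2⟩ := h _ hg'
  have h3 : Integrable (fun ω => g (Z ω)) P := by
    simpa [← mul_assoc, hK'.ne'] using h1.const_mul (K : ℝ)
  refine ⟨h3, fun t ht => ?_⟩
  convert h2 t ht using 4 with ω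
  rw [integral_const_mul, ← mul_sub, abs_mul, abs_of_pos (inv_pos.2 hK'),
    le_inv_mul_iff₀ hK']

/-- A bound for the fourth moment of a random variable with Gaussian tails. -/
def tailFourthMoment (C c : ℝ) : ENNReal :=
  ENNReal.ofReal 4 * ∫⁻ t in Set.Ioi (0 : ℝ),
    ENNReal.ofReal (C * Real.exp (-(t / c) ^ 2)) * ENNReal.ofReal (t ^ ((4 : ℝ) - 1))

lemma tailFourthMoment_ne_top (hC : 0 < C) (hc : 0 < c) : tailFourthMoment C c ≠ ⊤ := by
  refine ENNReal.mul_ne_top ENNReal.ofReal_ne_top ?_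
  have hi : IntegrableOn (fun t : ℝ => C * (t ^ (3 : ℝ) * Real.exp (-(1 / c ^ 2) * t ^ 2)))
      (Set.Ioi 0) :=
    ((integrable_rpow_mul_exp_neg_mul_sq (b := 1 / c ^ 2) (by positivity)
      (s := 3) (by norm_num)).const_mul C).integrableOn
  have hlt := hi.lintegral_lt_top
  refine ne_of_lt (lt_of_le_of_lt (lintegral_mono fun t => le_of_eq ?_) hlt)
  rw [← ENNReal.ofReal_mul (by positivity)]
  congr 1
  have : (t / c) ^ 2 = 1 / c ^ 2 * t ^ 2 := by ring
  rw [this]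
  norm_num
  ring

lemma lintegral_pow_four_le_of_tail [IsFiniteMeasure P] {W : Ω → ℝ} (hW : AEMeasurable W P)
    (h : ∀ t : ℝ, 0 < t → P.real {ω | t ≤ |W ω|} ≤ C * Real.exp (-(t / c) ^ 2)) :
    ∫⁻ ω, ENNReal.ofReal (|W ω| ^ 4) ∂P ≤ tailFourthMoment C c := by
  have e := lintegral_rpow_eq_lintegral_meas_le_mul P (f := fun ω => |W ω|)
    (Filter.Eventually.of_forall fun _ => abs_nonneg _) (by simpa using hW.norm)
    (p := 4) (by norm_num)
  have e4 : ∀ ω, |W ω| ^ (4 : ℝ) = |W ω| ^ 4 := fun ω => by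
    exact_mod_cast Real.rpow_natCast |W ω| 4
  simp_rw [e4] at e
  rw [e, tailFourthMoment]
  gcongr ENNReal.ofReal 4 * ?_
  refine setLIntegral_mono' measurableSet_Ioi fun t ht => ?_
  gcongr
  rw [← ofReal_measureReal]
  exact ENNReal.ofReal_le_ofReal (h t ht)

lemma add_pow_four_le (a b : ℝ) : (a + b) ^ 4 ≤ 8 * a ^ 4 + 8 * b ^ 4 := by
  nlinarith [sq_nonneg (a - b), sq_nonneg (a + b), sq_nonneg (a ^ 2 - b ^ 2),
    sq_nonneg ((a - b) * (a + b)), sq_nonneg ((a - b) ^ 2), mul_nonneg (sq_nonneg (a - b))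
      (sq_nonneg (a + b)), mul_nonneg (sq_nonneg (a - b)) (sq_nonneg a),
      mul_nonneg (sq_nonneg (a - b)) (sq_nonneg b)]

/-- A pointwise substitute for $\mathbb E[z]\le\mathbb E[z^4]^{1/4}$, with $\theta$ chosen
afterwards. -/
lemma le_add_pow_four_div {z θ : ℝ} (hz : 0 ≤ z) (hθ : 0 < θ) : z ≤ θ + z ^ 4 / θ ^ 3 := by
  rcases le_total z θ with h | h
  · have : 0 ≤ z ^ 4 / θ ^ 3 := by positivity
    linarith
  · have : z ≤ z ^ 4 / θ ^ 3 := by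
      rw [le_div_iff₀ (by positivity)]
      calc z * θ ^ 3 ≤ z * z ^ 3 := by gcongr
        _ = z ^ 4 := by ring
    linarith

/-- The constant in the fourth moment bound for linear forms. -/
def linearFourthMoment (C c m : ℝ) : ℝ := 8 * (tailFourthMoment C c).toReal + 8 * m ^ 4

lemma linearFourthMoment_nonneg (C c m : ℝ) : 0 ≤ linearFourthMoment C c m := by
  unfold linearFourthMoment
  have := ENNReal.toReal_nonneg (a := tailFourthMoment C c)
  have : 0 ≤ m ^ 4 := by positivity
  linarith

variable [MeasurableSpace E] [BorelSpace E] [SecondCountableTopology E]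

lemma ConcentratedWith.integrable (h : ConcentratedWith P Z C c) (hZ : Measurable Z) :
    Integrable Z P := by
  rw [← integrable_norm_iff hZ.aestronglyMeasurable]
  exact (h _ lipschitzWith_one_norm).1

variable [NormedSpace ℝ E] [CompleteSpace E]

/-- Normalize the form to norm at most one, so that it is a 1-Lipschitz observation: its fluctuation
has a Gaussian tail and its mean is at most $m$. -/
lemma ConcentratedWith.lintegral_pow_four_le [IsProbabilityMeasure P]
    (h : ConcentratedWith P Z C c) (hC : 0 < C) (hc : 0 < c) (hZ : Measurable Z) {m : ℝ}
    (hm : ‖∫ ω, Z ω ∂P‖ ≤ m) {φ : E →L[ℝ] ℝ} {l : ℝ} (hl : 0 < l) (hφ : ‖φ‖ ≤ l) :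
    ∫⁻ ω, ENNReal.ofReal (|φ (Z ω)| ^ 4) ∂P
      ≤ ENNReal.ofReal (linearFourthMoment C c m * l ^ 4) := by
  have hm0 : 0 ≤ m := (norm_nonneg _).trans hm
  set ψ : E →L[ℝ] ℝ := l⁻¹ • φ with hψ
  have hψ1 : ‖ψ‖ ≤ 1 := by
    rw [hψ, norm_smul, norm_inv, Real.norm_of_nonneg hl.le, inv_mul_le_iff₀ hl, mul_one]
    exact hφ
  have hlip : LipschitzWith 1 ψ := ψ.lipschitz.weaken (by exact_mod_cast hψ1)
  have hmean : |∫ ω, ψ (Z ω) ∂P| ≤ m := by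
    rw [ψ.integral_comp_comm (h.integrable hZ), ← Real.norm_eq_abs]
    refine (ψ.le_opNorm _).trans ?_
    calc _ ≤ 1 * m := by gcongr
      _ = m := one_mul m
  have hψm : Measurable fun ω => ψ (Z ω) := ψ.continuous.measurable.comp hZ
  have h1 := lintegral_pow_four_le_of_tail (P := P)
    (W := fun ω => ψ (Z ω) - ∫ ω', ψ (Z ω') ∂P) (hψm.sub_const _).aemeasurable (h ψ hlip).2
  have h2 : ∫⁻ ω, ENNReal.ofReal (|ψ (Z ω)| ^ 4) ∂P
      ≤ ENNReal.ofReal (linearFourthMoment C c m) := by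
    calc _ ≤ ∫⁻ ω, (ENNReal.ofReal 8 *
          ENNReal.ofReal (|ψ (Z ω) - ∫ ω', ψ (Z ω') ∂P| ^ 4) + ENNReal.ofReal (8 * m ^ 4)) ∂P := by
          refine lintegral_mono fun ω => ?_
          rw [← ENNReal.ofReal_mul (by norm_num), ← ENNReal.ofReal_add (by positivity)
            (by positivity)]
          refine ENNReal.ofReal_le_ofReal ?_
          have h3 : |ψ (Z ω)| ≤ |ψ (Z ω) - ∫ ω', ψ (Z ω') ∂P| + m := by
            have := abs_add_le (ψ (Z ω) - ∫ ω', ψ (Z ω') ∂P) (∫ ω', ψ (Z ω') ∂P)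
            rw [sub_add_cancel] at this
            linarith
          calc _ ≤ (|ψ (Z ω) - ∫ ω', ψ (Z ω') ∂P| + m) ^ 4 := by gcongr
            _ ≤ _ := add_pow_four_le _ _
      _ ≤ ENNReal.ofReal 8 * tailFourthMoment C c + ENNReal.ofReal (8 * m ^ 4) := by
          rw [lintegral_add_right _ measurable_const, lintegral_const, measure_univ, mul_one,
            lintegral_const_mul' _ _ ENNReal.ofReal_ne_top]
          gcongr
      _ = _ := by
          rw [linearFourthMoment, ENNReal.ofReal_add (by positivity) (by positivity),
            ENNReal.ofReal_mul (p := 8) (q := (tailFourthMoment C c).toReal) (by norm_num),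
            ENNReal.ofReal_toReal (tailFourthMoment_ne_top hC hc)]
  have e : ∀ ω, ENNReal.ofReal (|φ (Z ω)| ^ 4)
      = ENNReal.ofReal (l ^ 4) * ENNReal.ofReal (|ψ (Z ω)| ^ 4) := fun ω => by
    rw [← ENNReal.ofReal_mul (by positivity), hψ]
    congr 1
    rw [smul_apply, smul_eq_mul, abs_mul, abs_of_pos (inv_pos.2 hl), mul_pow,
      ← mul_assoc, ← mul_pow, mul_inv_cancel₀ hl.ne', one_pow, one_mul]
  simp_rw [e]
  rw [lintegral_const_mul' _ _ ENNReal.ofReal_ne_top, mul_comm,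
    ENNReal.ofReal_mul (linearFourthMoment_nonneg C c m)]
  gcongr

lemma lintegral_le_of_pow_four_le [IsProbabilityMeasure P] {W : Ω → ℝ} {θ K : ℝ} (hθ : 0 < θ)
    (hK : 0 ≤ K) (hW : ∀ ω, 0 ≤ W ω)
    (h : ∫⁻ ω, ENNReal.ofReal (W ω ^ 4) ∂P ≤ ENNReal.ofReal K) :
    ∫⁻ ω, ENNReal.ofReal (W ω) ∂P ≤ ENNReal.ofReal (θ + K / θ ^ 3) := by
  calc _ ≤ ∫⁻ ω, (ENNReal.ofReal (W ω ^ 4) * ENNReal.ofReal ((θ ^ 3)⁻¹) + ENNReal.ofReal θ) ∂P := by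
        refine lintegral_mono fun ω => ?_
        have := hW ω
        rw [← ENNReal.ofReal_mul (by positivity), ← ENNReal.ofReal_add (by positivity) hθ.le]
        refine ENNReal.ofReal_le_ofReal ?_
        have := le_add_pow_four_div this hθ
        rw [div_eq_mul_inv] at this
        linarith
    _ ≤ ENNReal.ofReal K * ENNReal.ofReal ((θ ^ 3)⁻¹) + ENNReal.ofReal θ := by
        rw [lintegral_add_right _ measurable_const, lintegral_const, measure_univ, mul_one,
          lintegral_mul_const' _ _ ENNReal.ofReal_ne_top]
        gcongr
    _ = _ := by
        rw [← ENNReal.ofReal_mul hK, ← ENNReal.ofReal_add (by positivity) hθ.le, add_comm,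
          div_eq_mul_inv]

end Moments

/-! ### Freezing an independent variable -/

section Freezing

variable {Ω α β : Type*} [MeasurableSpace Ω] [MeasurableSpace α] [MeasurableSpace β]
  {P : Measure Ω} {ξ : Ω → α} {Z : Ω → β}

/-- Fubini for the product law: a bound uniform in the frozen value $a$ survives integration over
$\xi$. -/
lemma lintegral_le_of_indepFun [IsProbabilityMeasure P] (hξ : Measurable ξ)
    (hZ : Measurable Z) (h : IndepFun ξ Z P)
    {F : α × β → ENNReal} (hF : Measurable F) {δ : ENNReal}
    (hδ : ∀ a, ∫⁻ ω, F (a, Z ω) ∂P ≤ δ) : ∫⁻ ω, F (ξ ω, Z ω) ∂P ≤ δ := by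
  have hmap := (indepFun_iff_map_prod_eq_prod_map_map hξ.aemeasurable hZ.aemeasurable).1 h
  have : IsProbabilityMeasure (P.map ξ) := Measure.isProbabilityMeasure_map hξ.aemeasurable
  have : IsProbabilityMeasure (P.map Z) := Measure.isProbabilityMeasure_map hZ.aemeasurable
  rw [← lintegral_map (f := F) hF (hξ.prodMk hZ), hmap, lintegral_prod _ hF.aemeasurable]
  calc _ ≤ ∫⁻ _, δ ∂(P.map ξ) := by
        refine lintegral_mono fun a => ?_
        rw [lintegral_map (f := fun y => F (a, y)) (hF.comp measurable_prodMk_left) hZ]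
        exact hδ a
    _ = δ := by simp

lemma measure_le_of_indepFun [IsProbabilityMeasure P] (hξ : Measurable ξ)
    (hZ : Measurable Z) (h : IndepFun ξ Z P)
    {T : Set (α × β)} (hT : MeasurableSet T) {δ : ENNReal}
    (hδ : ∀ a, P {ω | (a, Z ω) ∈ T} ≤ δ) : P {ω | (ξ ω, Z ω) ∈ T} ≤ δ := by
  have e : ∀ (η : Ω → α), Measurable η →
      ∫⁻ ω, T.indicator 1 (η ω, Z ω) ∂P = P {ω | (η ω, Z ω) ∈ T} := fun η hη => by
    exact lintegral_indicator_one (μ := P) ((hη.prodMk hZ) hT)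
  rw [← e ξ hξ]
  refine lintegral_le_of_indepFun hξ hZ h (measurable_one.indicator hT) fun a => ?_
  rw [e _ measurable_const]
  exact hδ a

lemma indepFun_update {n : ℕ} {E : Type*} [Zero E] [MeasurableSpace E] {x : Fin n → Ω → E}
    (hx : iIndepFun x P) (hm : ∀ j, Measurable (x j)) (i : Fin n) :
    IndepFun (fun ω => Function.update (fun j => x j ω) i 0) (x i) P := by
  classical
  have h := hx.indepFun_finset (Finset.univ.erase i) {i}
    (Finset.disjoint_singleton_right.2 (Finset.notMem_erase i _)) hm
  have h1 : Measurable fun (v : ↥(Finset.univ.erase i) → E) =>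
      (fun j : Fin n => if hj : j ∈ Finset.univ.erase i then v ⟨j, hj⟩ else 0) := by
    refine measurable_pi_lambda _ fun j => ?_
    by_cases hj : j ∈ Finset.univ.erase i
    · simp only [hj, dif_pos]
      exact measurable_pi_apply _
    · simp only [hj, dif_neg, not_false_eq_true]
      exact measurable_const
  have h2 : Measurable fun (v : ↥({i} : Finset (Fin n)) → E) => v ⟨i, Finset.mem_singleton_self i⟩ :=
    measurable_pi_apply _
  convert h.comp h1 h2 using 1
  · ext ω j
    by_cases hj : j = i
    · subst hj; simp
    · simp [hj]
  · rfl

end Freezing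

/-! ### The `ℓ⁴` norm -/

section Quartic

variable {n p : ℕ}

/-- The `ℓ⁴` norm of a finite family of reals. -/
def quarticNorm (a : Fin n → ℝ) : ℝ := (∑ j, |a j| ^ (4 : ℝ)) ^ (1 / (4 : ℝ))

lemma quarticNorm_nonneg (a : Fin n → ℝ) : 0 ≤ quarticNorm a :=
  Real.rpow_nonneg (Finset.sum_nonneg fun _ _ => by positivity) _

lemma quarticNorm_pow_four (a : Fin n → ℝ) : quarticNorm a ^ 4 = ∑ j, a j ^ 4 := by
  rw [quarticNorm, ← Real.rpow_natCast, ← Real.rpow_mul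
    (Finset.sum_nonneg fun _ _ => by positivity)]
  norm_num
  refine Finset.sum_congr rfl fun j _ => ?_
  exact Even.pow_abs (by decide) _

lemma quarticNorm_add_le (a b : Fin n → ℝ) :
    quarticNorm (fun j => a j + b j) ≤ quarticNorm a + quarticNorm b :=
  Real.Lp_add_le Finset.univ a b (by norm_num)

lemma quarticNorm_mul_left (r : ℝ) (a : Fin n → ℝ) :
    quarticNorm (fun j => r * a j) = |r| * quarticNorm a := by
  refine (pow_left_inj₀ (quarticNorm_nonneg _)
    (mul_nonneg (abs_nonneg _) (quarticNorm_nonneg _)) (n := 4) (by norm_num)).1 ?_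
  rw [mul_pow, quarticNorm_pow_four, quarticNorm_pow_four, Even.pow_abs (by decide),
    Finset.mul_sum]
  exact Finset.sum_congr rfl fun j _ => mul_pow _ _ _

/-- The inclusion of $\ell^2$ in $\ell^4$ has norm at most one. It transfers spectral norm bounds to
the $\ell^4$ norm. -/
lemma quarticNorm_le_sqrt (a : Fin n → ℝ) : quarticNorm a ≤ √(∑ j, a j ^ 2) := by
  refine (pow_le_pow_iff_left₀ (quarticNorm_nonneg _) (Real.sqrt_nonneg _)
    (n := 4) (by norm_num)).1 ?_
  have e : √(∑ j, a j ^ 2) ^ 4 = (∑ j, a j ^ 2) ^ 2 := by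
    rw [show 4 = 2 * 2 by norm_num, pow_mul, Real.sq_sqrt (Finset.sum_nonneg fun _ _ => sq_nonneg _)]
  rw [quarticNorm_pow_four, e]
  calc _ = ∑ j, (a j ^ 2) ^ 2 := Finset.sum_congr rfl fun j _ => by ring
    _ ≤ _ := Finset.sum_sq_le_sq_sum_of_nonneg fun _ _ => sq_nonneg _

lemma quarticNorm_inner_le (x : Fin n → EuclideanSpace ℝ (Fin p)) (v : EuclideanSpace ℝ (Fin p)) :
    quarticNorm (fun j => inner ℝ (x j) v) ≤ √(gramNorm x) * ‖v‖ := by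
  refine (quarticNorm_le_sqrt _).trans ?_
  rw [← Real.sqrt_sq (norm_nonneg v), ← Real.sqrt_mul (gramNorm_nonneg x)]
  exact Real.sqrt_le_sqrt (sum_inner_sq_le_gramNorm x v)

lemma measurable_quarticNorm : Measurable (quarticNorm : (Fin n → ℝ) → ℝ) := by
  unfold quarticNorm
  fun_prop

end Quartic

/-! ### Deterministic bounds for the leave-one-out expansion -/

section Expansion

/-- Mean value inequality for $s\mapsto f(s)-f'(u)s$ on the segment. It loses the factor $1/2$ but
needs no regularity of $f''$ beyond boundedness. -/
lemma abs_taylor_le {f : ℝ → ℝ} (hf : Differentiable ℝ f) (hf' : Differentiable ℝ (deriv f))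
    {L : ℝ} (hL : ∀ u, |deriv (deriv f) u| ≤ L) (u v : ℝ) :
    |f v - f u - deriv f u * (v - u)| ≤ L * (v - u) ^ 2 := by
  have hd : ∀ s, HasDerivAt (fun s => f s - deriv f u * s) (deriv f s - deriv f u) s := fun s => by
    have h := (hf s).hasDerivAt.fun_sub ((hasDerivAt_id' s).const_mul (deriv f u))
    rwa [mul_one] at h
  have h := Convex.norm_image_sub_le_of_norm_deriv_le (f := fun s => f s - deriv f u * s)
    (s := Set.uIcc u v) (C := L * |v - u|) (fun s _ => (hd s).differentiableAt) (fun s hs => by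
      rw [(hd s).deriv, Real.norm_eq_abs]
      refine (abs_sub_le_of_deriv_le hf' hL s u).trans ?_
      have hL0 : 0 ≤ L := (abs_nonneg _).trans (hL u)
      exact mul_le_mul_of_nonneg_left (Set.abs_sub_left_of_mem_uIcc hs) hL0)
    (convex_uIcc u v) Set.left_mem_uIcc Set.right_mem_uIcc
  rw [Real.norm_eq_abs, Real.norm_eq_abs, mul_assoc, abs_mul_abs_self] at h
  calc _ = |f v - deriv f u * v - (f u - deriv f u * u)| := by congr 1; ring
    _ ≤ _ := h
    _ = _ := by ring

variable {n p : ℕ} {f : ℝ → ℝ} {lam ε L B : ℝ} {x : Fin n → EuclideanSpace ℝ (Fin p)}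

/-- The linear forms `v ↦ xⱼᵀ v`, `j ≠ i`. -/
def otherForms (x : Fin n → EuclideanSpace ℝ (Fin p)) (i : Fin n) (v : EuclideanSpace ℝ (Fin p))
    (j : Fin n) : ℝ := inner ℝ (Function.update x i 0 j) v

/-- `y₋ᵢ(t) - Y₋ᵢ - (t/n) f(xᵢᵀ y₋ᵢ(t)) Q₋ᵢ xᵢ`. -/
def bridgeResidual (f : ℝ → ℝ) (x : Fin n → EuclideanSpace ℝ (Fin p)) (i : Fin n) (t : ℝ) :
    EuclideanSpace ℝ (Fin p) :=
  bridge f x i t - leaveOneOut f x i - (t / (n : ℝ)) • f (inner ℝ (x i) (bridge f x i t)) •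
    Matrix.toEuclideanCLM (𝕜 := ℝ) (n := Fin p) (resolvent f x i) (x i)

lemma residualNorm_eq (f : ℝ → ℝ) (x : Fin n → EuclideanSpace ℝ (Fin p)) (i : Fin n) :
    residualNorm f x i = ‖bridgeResidual f x i 1‖ := by
  rw [residualNorm, bridgeResidual, regressor_eq_bridge f x i]

lemma sqrt_gramNorm_le (hn : 0 < n) (hε : 0 < ε) (hlam : 0 < lam)
    (hx : lam / n * gramNorm x ≤ 1 - ε) : √(gramNorm x) ≤ √(n / lam) :=
  Real.sqrt_le_sqrt (gramNorm_le_div hn hε hlam hx)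

lemma norm_col_le (hn : 0 < n) (hε : 0 < ε) (hlam : 0 < lam)
    (hx : lam / n * gramNorm x ≤ 1 - ε) (i : Fin n) : ‖x i‖ ≤ √(n / lam) := by
  refine le_trans ?_ (sqrt_gramNorm_le hn hε hlam hx)
  exact Real.le_sqrt_of_sq_le (norm_sq_le_gramNorm x i)

lemma quarticNorm_otherForms_le (hn : 0 < n) (hε : 0 < ε) (hlam : 0 < lam)
    (hx : lam / n * gramNorm x ≤ 1 - ε) (i : Fin n) (v : EuclideanSpace ℝ (Fin p)) :
    quarticNorm (otherForms x i v) ≤ √(n / lam) * ‖v‖ :=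
  (quarticNorm_inner_le _ v).trans (mul_le_mul_of_nonneg_right
    (sqrt_gramNorm_le hn hε hlam (update_mem_goodData hlam.le hx i)) (norm_nonneg _))

/-- Subtracting the two fixed-point equations cancels the $x_i$ term against
$Q_{-i}^{-1}Q_{-i}x_i=x_i$, and the matrix removes the linear part of $f$ at $x_j^TY_{-i}$. -/
lemma preResolvent_bridgeResidual (hε : 0 < ε) (hlam : 0 ≤ lam)
    (hflam : ∀ u, |deriv f u| ≤ lam) (hfl : ∀ u v, |f u - f v| ≤ lam * |u - v|)
    (hx : lam / n * gramNorm x ≤ 1 - ε) (i : Fin n) {t : ℝ} (ht : t ∈ Set.Icc (0 : ℝ) 1) :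
    Matrix.toEuclideanCLM (𝕜 := ℝ) (n := Fin p) (preResolvent f x i) (bridgeResidual f x i t)
      = (1 / (n : ℝ)) • ∑ j, (if j = i then 0 else
        f (inner ℝ (x j) (bridge f x i t)) - f (inner ℝ (x j) (leaveOneOut f x i))
          - deriv f (inner ℝ (x j) (leaveOneOut f x i))
            * inner ℝ (x j) (bridge f x i t - leaveOneOut f x i)) • x j := by
  rw [bridgeResidual, map_sub, map_smul, map_smul,
    preResolvent_resolvent_apply hε hlam hflam hx, toEuclideanCLM_preResolvent]
  set y := bridge f x i t with hy
  set z := leaveOneOut f x i with hz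
  have h1 : y = leaveOneOutMap f x i y + (t / (n : ℝ)) • f (inner ℝ (x i) y) • x i :=
    uniqueFixedPoint_spec (existsUnique_bridgeMap hε hlam hfl hx i ht)
  have h2 : z = leaveOneOutMap f x i z := by
    refine uniqueFixedPoint_spec ?_
    rw [leaveOneOutMap_eq_bridgeMap]
    exact existsUnique_bridgeMap hε hlam hfl hx i ⟨le_rfl, zero_le_one⟩
  have h3 : ∀ v, leaveOneOutMap f x i v
      = (1 / (n : ℝ)) • ∑ j, (if j = i then 0 else f (inner ℝ (x j) v)) • x j := fun v => by
    rw [leaveOneOutMap, ← Finset.sum_erase_add _ _ (Finset.mem_univ i)]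
    simp only [if_true, zero_smul, add_zero]
    congr 1
    exact Finset.sum_congr rfl fun j hj => by rw [if_neg (Finset.ne_of_mem_erase hj)]
  have h4 : y - z - (t / (n : ℝ)) • f (inner ℝ (x i) y) • x i
      = leaveOneOutMap f x i y - leaveOneOutMap f x i z := by
    nth_rewrite 1 [h1]
    nth_rewrite 1 [h2]
    abel
  rw [sub_right_comm, h4, h3, h3, ← smul_sub, ← smul_sub, ← Finset.sum_sub_distrib,
    ← Finset.sum_sub_distrib]
  congr 1
  refine Finset.sum_congr rfl fun j _ => ?_
  rw [← sub_smul, ← sub_smul]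
  congr 1
  split_ifs <;> ring

/-- The remainders are quadratic in $x_j^T\Delta$, so their $\ell^2$ norm is the square of an
$\ell^4$ norm. Synthesis costs $\sqrt{n/\lambda}$ and inversion costs $\varepsilon^{-1}$. -/
lemma norm_bridgeResidual_le (hn : 0 < n) (hε : 0 < ε) (hlam : 0 < lam)
    (hf : Differentiable ℝ f) (hf' : Differentiable ℝ (deriv f))
    (hflam : ∀ u, |deriv f u| ≤ lam) (hL : ∀ u, |deriv (deriv f) u| ≤ L)
    (hx : lam / n * gramNorm x ≤ 1 - ε) (i : Fin n) {t : ℝ} (ht : t ∈ Set.Icc (0 : ℝ) 1) :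
    ‖bridgeResidual f x i t‖ ≤ L / (ε * lam) / √(n / lam) *
      quarticNorm (otherForms x i (bridge f x i t - leaveOneOut f x i)) ^ 2 := by
  have hfl := abs_sub_le_of_deriv_le hf hflam
  have hL0 : 0 ≤ L := (abs_nonneg _).trans (hL 0)
  have hn' : (0 : ℝ) < n := by exact_mod_cast hn
  have hM := norm_le_norm_preResolvent (f := f) hlam.le hflam hx i (bridgeResidual f x i t)
  rw [preResolvent_bridgeResidual hε hlam.le hflam hfl hx i ht, norm_smul,
    Real.norm_of_nonneg (by positivity)] at hM
  set r : Fin n → ℝ := fun j => if j = i then 0 else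
        f (inner ℝ (x j) (bridge f x i t)) - f (inner ℝ (x j) (leaveOneOut f x i))
          - deriv f (inner ℝ (x j) (leaveOneOut f x i))
            * inner ℝ (x j) (bridge f x i t - leaveOneOut f x i) with hr
  set Δ := bridge f x i t - leaveOneOut f x i with hΔ
  set q := quarticNorm (otherForms x i Δ) with hq
  have hq0 : 0 ≤ q := quarticNorm_nonneg _
  have hrj : ∀ j, r j ^ 2 ≤ L ^ 2 * otherForms x i Δ j ^ 4 := fun j => by
    by_cases hj : j = i
    · simp only [hr, if_pos hj]
      rw [zero_pow two_ne_zero]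
      positivity
    · have h1 : |r j| ≤ L * otherForms x i Δ j ^ 2 := by
        simp only [hr, if_neg hj, otherForms, Function.update_of_ne hj]
        rw [hΔ, inner_sub_right]
        exact abs_taylor_le hf hf' hL _ _
      calc r j ^ 2 = |r j| ^ 2 := (sq_abs _).symm
        _ ≤ (L * otherForms x i Δ j ^ 2) ^ 2 := by gcongr
        _ = _ := by ring
  have hS : ‖∑ j, r j • x j‖ ≤ √(n / lam) * (L * q ^ 2) := by
    refine le_of_sq_le_sq ?_ (by positivity)
    calc _ ≤ gramNorm x * ∑ j, r j ^ 2 := norm_sum_smul_sq_le_gramNorm x r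
      _ ≤ (n / lam) * (L ^ 2 * q ^ 4) := by
        refine mul_le_mul (gramNorm_le_div hn hε hlam hx) ?_
          (Finset.sum_nonneg fun _ _ => sq_nonneg _) (by positivity)
        rw [hq, quarticNorm_pow_four, Finset.mul_sum]
        exact Finset.sum_le_sum fun j _ => hrj j
      _ = _ := by
        rw [mul_pow, Real.sq_sqrt (by positivity)]
        ring
  have hg : 0 < √(n / lam) := by positivity
  have e : (n : ℝ) = lam * √(n / lam) ^ 2 := by
    rw [Real.sq_sqrt (by positivity)]
    field_simp
  calc ‖bridgeResidual f x i t‖ ≤ (1 / (n : ℝ) * ‖∑ j, r j • x j‖) / ε := by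
        rw [le_div_iff₀' hε]
        exact hM
    _ ≤ (1 / (n : ℝ) * (√(n / lam) * (L * q ^ 2))) / ε := by gcongr
    _ = L / (ε * lam) / √(n / lam) * q ^ 2 := by
        set g := √(n / lam)
        rw [e]
        field_simp

lemma norm_correction_le (hn : 0 < n) (hε : 0 < ε) (hlam : 0 < lam)
    (hflam : ∀ u, |deriv f u| ≤ lam) (hB : ∀ u, |f u| ≤ B)
    (hx : lam / n * gramNorm x ≤ 1 - ε) (i : Fin n) (u : ℝ) {t : ℝ} (ht : t ∈ Set.Icc (0 : ℝ) 1) :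
    ‖(t / (n : ℝ)) • f u • Matrix.toEuclideanCLM (𝕜 := ℝ) (n := Fin p) (resolvent f x i) (x i)‖
      ≤ ε⁻¹ * (1 / n * (B * √(n / lam))) := by
  have hB0 : 0 ≤ B := (abs_nonneg _).trans (hB 0)
  rw [norm_smul, norm_smul, Real.norm_eq_abs, Real.norm_eq_abs, abs_div, Nat.abs_cast,
    abs_of_nonneg ht.1]
  calc _ ≤ 1 / (n : ℝ) * (B * (ε⁻¹ * √(n / lam))) := by
        gcongr
        · exact ht.2
        · exact hB u
        · exact (norm_resolvent_le hε hlam.le hflam hx i _).trans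
            (mul_le_mul_of_nonneg_left (norm_col_le hn hε hlam hx i) (by positivity))
    _ = _ := by ring

/-- The crude bound for the residual. -/
lemma residualNorm_le_crude (hn : 0 < n) (hε : 0 < ε) (hlam : 0 < lam)
    (hf : Differentiable ℝ f)
    (hflam : ∀ u, |deriv f u| ≤ lam) (hB : ∀ u, |f u| ≤ B)
    (hx : lam / n * gramNorm x ≤ 1 - ε) (i : Fin n) :
    residualNorm f x i ≤ 2 * B / (ε * lam) / √(n / lam) := by
  have hfl := abs_sub_le_of_deriv_le hf hflam
  have hB0 : 0 ≤ B := (abs_nonneg _).trans (hB 0)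
  have hn' : (0 : ℝ) < n := by exact_mod_cast hn
  have hg : 0 < √(n / lam) := by positivity
  have e : (n : ℝ) = lam * √(n / lam) ^ 2 := by
    rw [Real.sq_sqrt (by positivity)]
    field_simp
  have h1 : ‖bridge f x i 1 - leaveOneOut f x i‖ ≤ ε⁻¹ * (1 / n * (B * √(n / lam))) := by
    rw [leaveOneOut_eq_bridge]
    refine (norm_bridge_sub_bridge_le hε hlam.le hfl hx i (s := 0) (t := 1)
      ⟨le_rfl, zero_le_one⟩ ⟨zero_le_one, le_rfl⟩).trans ?_
    rw [sub_zero, abs_one]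
    gcongr
    · exact hB _
    · exact norm_col_le hn hε hlam hx i
  have h2 := norm_correction_le hn hε hlam hflam hB hx i
    (inner ℝ (x i) (bridge f x i 1)) (t := 1) ⟨zero_le_one, le_rfl⟩
  rw [residualNorm_eq, bridgeResidual]
  refine (norm_sub_le _ _).trans ((add_le_add h1 h2).trans (le_of_eq ?_))
  set g := √(n / lam)
  rw [e]
  field_simp
  ring

lemma continuousOn_norm_bridgeResidual (hf : Continuous f) (hε : 0 < ε) (hlam : 0 ≤ lam)
    (hfl : ∀ u v, |f u - f v| ≤ lam * |u - v|)
    (hx : lam / n * gramNorm x ≤ 1 - ε) (i : Fin n) :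
    ContinuousOn (fun t => ‖bridgeResidual f x i t‖) (Set.Icc 0 1) := by
  have h := continuousOn_bridge hε hlam hfl hx i
  unfold bridgeResidual
  have h2 : ContinuousOn (fun t => f (inner ℝ (x i) (bridge f x i t))) (Set.Icc 0 1) :=
    hf.comp_continuousOn (continuousOn_const.inner h)
  fun_prop

/-- Below the threshold $1/(4ag)$ the quadratic term is at most $R/2$ and is absorbed on the left.
-/
lemma le_of_le_add_sq {R A g w a : ℝ} (hR : 0 ≤ R) (hA : A = 2 * a / g * w ^ 2)
    (h : R ≤ A + 2 * a * g * R ^ 2) (hs : 4 * a * g * R ≤ 1) : R ≤ 4 * a / g * w ^ 2 := by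
  have h1 : 2 * a * g * R ^ 2 ≤ R / 2 := by nlinarith
  have h2 : 4 * a / g * w ^ 2 = 2 * A := by rw [hA]; ring
  linarith

/-- The residual is controlled by the `ℓ⁴` norm of the forms `xⱼᵀ Q₋ᵢ xᵢ`, `j ≠ i`; the bridge
between `Y₋ᵢ` and `Y` selects the small solution of a quadratic inequality. -/
lemma residualNorm_le (hn : 0 < n) (hε : 0 < ε) (hlam : 0 < lam)
    (hf : Differentiable ℝ f) (hf' : Differentiable ℝ (deriv f))
    (hflam : ∀ u, |deriv f u| ≤ lam) (hL0 : 0 < L) (hL : ∀ u, |deriv (deriv f) u| ≤ L)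
    (hB : ∀ u, |f u| ≤ B)
    (hx : lam / n * gramNorm x ≤ 1 - ε) (i : Fin n) :
    residualNorm f x i ≤
      (4 * (L / (ε * lam)) + 16 * (L / (ε * lam)) ^ 2 * (2 * B / (ε * lam))) / √(n / lam) *
        (B / n * quarticNorm (otherForms x i
          (Matrix.toEuclideanCLM (𝕜 := ℝ) (n := Fin p) (resolvent f x i) (x i)))) ^ 2 := by
  have hfl := abs_sub_le_of_deriv_le hf hflam
  have hB0 : 0 ≤ B := (abs_nonneg _).trans (hB 0)
  have hn' : (0 : ℝ) < n := by exact_mod_cast hn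
  have hcrude := residualNorm_le_crude hn hε hlam hf hflam hB hx i
  set g := √(n / lam) with hg
  have hg0 : 0 < g := by positivity
  set a := L / (ε * lam) with ha
  have ha0 : 0 < a := by positivity
  set b := 2 * B / (ε * lam) with hb
  have hb0 : 0 ≤ b := by positivity
  set v := Matrix.toEuclideanCLM (𝕜 := ℝ) (n := Fin p) (resolvent f x i) (x i) with hv
  set w := B / n * quarticNorm (otherForms x i v) with hw
  have hw0 : 0 ≤ w := mul_nonneg (by positivity) (quarticNorm_nonneg _)
  -- Split $y_{-i}(t)-Y_{-i}$ into its explicit part along $v=Q_{-i}x_i$, of $\ell^4$ size at most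
  -- $w$, and the residual, of $\ell^4$ size at most $gR$.
  have hquad : ∀ t ∈ Set.Icc (0 : ℝ) 1, ‖bridgeResidual f x i t‖
      ≤ 2 * a / g * w ^ 2 + 2 * a * g * ‖bridgeResidual f x i t‖ ^ 2 := by
    intro t ht
    set R := ‖bridgeResidual f x i t‖ with hR
    have hR0 : 0 ≤ R := norm_nonneg _
    have h1 := norm_bridgeResidual_le hn hε hlam hf hf' hflam hL hx i ht
    have h2 : quarticNorm (otherForms x i (bridge f x i t - leaveOneOut f x i)) ≤ w + g * R := by
      set k := t / (n : ℝ) * f (inner ℝ (x i) (bridge f x i t)) with hk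
      have e : otherForms x i (bridge f x i t - leaveOneOut f x i)
          = fun j => k * otherForms x i v j + otherForms x i (bridgeResidual f x i t) j := by
        ext j
        simp only [otherForms, bridgeResidual, hk, smul_smul]
        rw [inner_sub_right _ (bridge f x i t - leaveOneOut f x i), real_inner_smul_right]
        ring
      rw [e]
      refine (quarticNorm_add_le _ _).trans (add_le_add ?_ ?_)
      · rw [quarticNorm_mul_left, hw]
        refine mul_le_mul_of_nonneg_right ?_ (quarticNorm_nonneg _)
        rw [hk, abs_mul, abs_div, Nat.abs_cast, abs_of_nonneg ht.1]
        calc t / (n : ℝ) * |f (inner ℝ (x i) (bridge f x i t))| ≤ 1 / n * B := by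
              gcongr
              · exact ht.2
              · exact hB _
          _ = B / n := by ring
      · exact quarticNorm_otherForms_le hn hε hlam hx i _
    have h3 : quarticNorm (otherForms x i (bridge f x i t - leaveOneOut f x i)) ^ 2
        ≤ 2 * w ^ 2 + 2 * (g * R) ^ 2 := by
      calc _ ≤ (w + g * R) ^ 2 := by
            gcongr
            exact quarticNorm_nonneg _
        _ ≤ _ := by nlinarith [sq_nonneg (w - g * R)]
    calc R ≤ a / g * (2 * w ^ 2 + 2 * (g * R) ^ 2) := h1.trans (by gcongr)
      _ = _ := by field_simp
  rw [residualNorm_eq] at hcrude ⊢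
  have hw2 : 0 ≤ w ^ 2 / g := by positivity
  by_cases hc : 4 * a * g * ‖bridgeResidual f x i 1‖ ≤ 1
  · have h1 := le_of_le_add_sq (norm_nonneg _) rfl (hquad 1 ⟨zero_le_one, le_rfl⟩) hc
    refine h1.trans ?_
    gcongr
    have : 0 ≤ 16 * a ^ 2 * b := by positivity
    linarith
  -- The residual starts at $0$ and ends above the threshold, so it equals $1/(4ag)$ at some $t$.
  -- Absorption at that $t$ forces $16a^2w^2\ge1$, and multiplying the crude bound by this factor
  -- gives the required form.
  · push Not at hc
    have hzero : ‖bridgeResidual f x i 0‖ = 0 := by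
      simp [bridgeResidual, leaveOneOut_eq_bridge]
    have hr : 1 / (4 * a * g) ∈ Set.Icc (‖bridgeResidual f x i 0‖) (‖bridgeResidual f x i 1‖) := by
      rw [hzero]
      refine ⟨by positivity, ?_⟩
      rw [div_le_iff₀ (by positivity)]
      linarith
    obtain ⟨t, ht, hRt⟩ := intermediate_value_Icc zero_le_one
      (continuousOn_norm_bridgeResidual hf.continuous hε hlam.le hfl hx i) hr
    simp only at hRt
    have h1 := le_of_le_add_sq (norm_nonneg _) rfl (hquad t ht)
      (by rw [hRt]; exact le_of_eq (by field_simp))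
    rw [hRt] at h1
    have h2 : 1 ≤ 16 * a ^ 2 * w ^ 2 := by
      rw [div_le_iff₀ (by positivity)] at h1
      calc 1 ≤ 4 * a / g * w ^ 2 * (4 * a * g) := h1
        _ = _ := by field_simp; ring
    calc ‖bridgeResidual f x i 1‖ ≤ b / g := hcrude
      _ ≤ b / g * (16 * a ^ 2 * w ^ 2) := le_mul_of_one_le_right (by positivity) h2
      _ = 16 * a ^ 2 * b / g * w ^ 2 := by ring
      _ ≤ _ := by
        gcongr
        linarith

end Expansion

/-! ### The good event -/

section GoodEvent

variable {Ω : Type*} [MeasurableSpace Ω] {P : Measure Ω} {n p : ℕ}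
  {x : Fin n → Ω → EuclideanSpace ℝ (Fin p)} {C c lam ε : ℝ}

lemma ConcentratedWith.column
    (hX : ConcentratedWith (E := PiLp 2 fun _ : Fin n => EuclideanSpace ℝ (Fin p)) P
      (fun ω => WithLp.toLp 2 fun j => x j ω) C c) (i : Fin n) :
    ConcentratedWith P (x i) C c :=
  hX.comp (φ := fun X : PiLp 2 fun _ : Fin n => EuclideanSpace ℝ (Fin p) => X.ofLp i)
    (LipschitzWith.of_dist_le_mul fun X Y => by
      rw [NNReal.coe_one, one_mul, dist_eq_norm, dist_eq_norm, ← PiLp.sub_apply]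
      exact PiLp.norm_apply_le _ i)

lemma measurable_data (hm : ∀ j, Measurable (x j)) : Measurable fun ω j => x j ω :=
  measurable_pi_lambda _ hm

lemma measurable_update_data (hm : ∀ j, Measurable (x j)) (i : Fin n) :
    Measurable fun ω => Function.update (fun j => x j ω) i 0 := by
  refine measurable_pi_lambda _ fun j => ?_
  by_cases hj : j = i
  · subst hj; simp
  · simpa [hj] using hm j

lemma measurableSet_goodEvent (hm : ∀ j, Measurable (x j)) :
    MeasurableSet (goodEvent x lam ε) :=
  measurable_data hm (measurableSet_goodData lam ε)

/-- Concentration directly integrates only $\sqrt{\|XX^T\|}$; its square is integrable by the fourth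
moment of the fluctuation. -/
lemma integrable_gramNorm [IsProbabilityMeasure P] (hC : 0 < C) (hc : 0 < c)
    (hX : ConcentratedWith (E := PiLp 2 fun _ : Fin n => EuclideanSpace ℝ (Fin p)) P
      (fun ω => WithLp.toLp 2 fun j => x j ω) C c) :
    Integrable (fun ω => gramNorm fun j => x j ω) P := by
  obtain ⟨h1, h2⟩ := hX _ lipschitzWith_sqrt_gramNorm
  simp only at h1 h2
  set μ := ∫ ω, √(gramNorm fun j => x j ω) ∂P with hμ
  set W : Ω → ℝ := fun ω => √(gramNorm fun j => x j ω) - μ with hW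
  have hWi : Integrable W P := h1.sub (integrable_const μ)
  have h4 := (lintegral_pow_four_le_of_tail hWi.aemeasurable h2).trans_lt
    (tailFourthMoment_ne_top hC hc).lt_top
  have h4i : Integrable (fun ω => |W ω| ^ 4) P :=
    (lintegral_ofReal_ne_top_iff_integrable
      (hWi.aestronglyMeasurable.norm.pow 4)
      (Filter.Eventually.of_forall fun _ => pow_nonneg (abs_nonneg _) 4)).1 h4.ne
  have h2i : Integrable (fun ω => W ω ^ 2) P := by
    refine (h4i.add (integrable_const 1)).mono' (hWi.aestronglyMeasurable.pow 2)
      (Filter.Eventually.of_forall fun ω => ?_)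
    rw [Real.norm_of_nonneg (sq_nonneg _)]
    simp only [Pi.add_apply]
    rw [← sq_abs (W ω)]
    nlinarith [sq_nonneg (|W ω| ^ 2 - 1), sq_nonneg (|W ω|)]
  have := (h2i.add (hWi.const_mul (2 * μ))).add (integrable_const (μ ^ 2))
  refine this.congr (Filter.Eventually.of_forall fun ω => ?_)
  simp only [Pi.add_apply, hW]
  have e := Real.sq_sqrt (gramNorm_nonneg fun j => x j ω)
  linarith [e]

/-- Markov: the complement has probability at most
$(1-2\varepsilon)/(1-\varepsilon)\le1-\varepsilon$. -/
lemma le_measureReal_goodEvent [IsProbabilityMeasure P] (hm : ∀ j, Measurable (x j))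
    (hlam : 0 ≤ lam) (hε : 0 < ε)
    (hi : Integrable (fun ω => gramNorm fun j => x j ω) P)
    (hcontr : 2 * ε ≤ 1 - lam / n * ∫ ω, gramNorm (fun j => x j ω) ∂P) :
    ε ≤ P.real (goodEvent x lam ε) := by
  have h0 : 0 ≤ lam / n * ∫ ω, gramNorm (fun j => x j ω) ∂P :=
    mul_nonneg (by positivity) (integral_nonneg fun ω => gramNorm_nonneg _)
  have hM := mul_meas_ge_le_integral_of_nonneg (μ := P)
    (f := fun ω => lam / n * gramNorm fun j => x j ω)
    (Filter.Eventually.of_forall fun ω => mul_nonneg (by positivity) (gramNorm_nonneg _))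
    (hi.const_mul _) (1 - ε)
  rw [integral_const_mul] at hM
  have hsub : P.real (goodEvent x lam ε)ᶜ
      ≤ P.real {ω | 1 - ε ≤ lam / n * gramNorm fun j => x j ω} := by
    refine measureReal_mono fun ω hω => ?_
    simp only [goodEvent, Set.mem_compl_iff, Set.mem_ofPred_eq, not_le] at hω
    exact hω.le
  have hcompl : P.real (goodEvent x lam ε)ᶜ = 1 - P.real (goodEvent x lam ε) :=
    probReal_compl_eq_one_sub (measurableSet_goodEvent hm)
  have h1 : 0 < 1 - ε := by linarith
  have h2 : (1 - ε) * P.real (goodEvent x lam ε)ᶜ ≤ 1 - 2 * ε :=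
    (mul_le_mul_of_nonneg_left hsub h1.le).trans (hM.trans (by linarith))
  rw [hcompl] at h2
  by_contra hcon
  push Not at hcon
  nlinarith

lemma measureReal_goodEvent_compl_le [IsProbabilityMeasure P] (hn : 0 < n)
    (hlam : 0 < lam) (hε : 0 < ε)
    (hX : ConcentratedWith (E := PiLp 2 fun _ : Fin n => EuclideanSpace ℝ (Fin p)) P
      (fun ω => WithLp.toLp 2 fun j => x j ω) C c)
    (hi : Integrable (fun ω => gramNorm fun j => x j ω) P)
    (hcontr : 2 * ε ≤ 1 - lam / n * ∫ ω, gramNorm (fun j => x j ω) ∂P) :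
    P.real (goodEvent x lam ε)ᶜ
      ≤ C * Real.exp (-((√(1 - ε) - √(1 - 2 * ε)) ^ 2 / (lam * c ^ 2) * n)) := by
  have hn' : (0 : ℝ) < n := by exact_mod_cast hn
  have h0 : 0 ≤ lam / n * ∫ ω, gramNorm (fun j => x j ω) ∂P :=
    mul_nonneg (by positivity) (integral_nonneg fun ω => gramNorm_nonneg _)
  obtain ⟨h1, h2⟩ := hX _ lipschitzWith_sqrt_gramNorm
  simp only at h1 h2
  set μ := ∫ ω, √(gramNorm fun j => x j ω) ∂P with hμ
  have hδ : 0 < √(1 - ε) - √(1 - 2 * ε) :=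
    sub_pos.2 (Real.sqrt_lt_sqrt (by linarith) (by linarith))
  have hg : 0 < √(n / lam) := by positivity
  -- Nonnegativity of the variance of $\sqrt{\|XX^T\|}$ bounds $\mu^2$ by $\mathbb E\|XX^T\|$.
  have hμle : μ ≤ √(n / lam) * √(1 - 2 * ε) := by
    rw [← Real.sqrt_mul (by positivity)]
    refine Real.le_sqrt_of_sq_le ?_
    have hvar : 0 ≤ ∫ ω, (√(gramNorm fun j => x j ω) - μ) ^ 2 ∂P :=
      integral_nonneg fun ω => sq_nonneg _
    have e : ∀ ω, (√(gramNorm fun j => x j ω) - μ) ^ 2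
        = (gramNorm fun j => x j ω) - 2 * μ * √(gramNorm fun j => x j ω) + μ ^ 2 := fun ω => by
      have e := Real.sq_sqrt (gramNorm_nonneg fun j => x j ω)
      linarith [e]
    simp_rw [e] at hvar
    have hs : Integrable (fun ω => 2 * μ * √(gramNorm fun j => x j ω)) P := h1.const_mul _
    have hd : Integrable (fun ω => (gramNorm fun j => x j ω) - 2 * μ * √(gramNorm fun j => x j ω))
      P := hi.sub hs
    rw [integral_add hd (integrable_const _), integral_sub hi hs, integral_const_mul,
      integral_const, ← hμ] at hvar
    simp only [probReal_univ, smul_eq_mul, one_mul] at hvar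
    have hgm : ∫ ω, gramNorm (fun j => x j ω) ∂P ≤ n / lam * (1 - 2 * ε) := by
      rw [div_mul_eq_mul_div, le_div_iff₀ hlam]
      have : lam / n * ∫ ω, gramNorm (fun j => x j ω) ∂P ≤ 1 - 2 * ε := by linarith
      rw [div_mul_eq_mul_div, div_le_iff₀ hn'] at this
      linarith
    nlinarith
  refine le_trans (measureReal_mono fun ω hω => ?_)
    ((h2 (√(n / lam) * (√(1 - ε) - √(1 - 2 * ε))) (by positivity)).trans (le_of_eq ?_))
  · simp only [goodEvent, Set.mem_compl_iff, Set.mem_ofPred_eq, not_le] at hω ⊢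
    have h3 : √(n / lam) * √(1 - ε) ≤ √(gramNorm fun j => x j ω) := by
      rw [← Real.sqrt_mul (by positivity)]
      refine Real.sqrt_le_sqrt ?_
      rw [div_mul_eq_mul_div, div_le_iff₀ hlam]
      rw [div_mul_eq_mul_div, lt_div_iff₀ hn'] at hω
      linarith
    refine le_trans ?_ (le_abs_self _)
    rw [mul_sub]
    linarith
  · congr 3
    rw [div_pow, mul_pow, Real.sq_sqrt (by positivity)]
    field_simp

lemma cond_real_le [IsProbabilityMeasure P] {A S : Set Ω} (hA : MeasurableSet A)
    (hε : 0 < ε) (h : ε ≤ P.real A) :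
    (P[|A]).real S ≤ ε⁻¹ * P.real (A ∩ S) := by
  rw [measureReal_def, cond_apply hA, ENNReal.toReal_mul, ENNReal.toReal_inv]
  exact mul_le_mul_of_nonneg_right (inv_anti₀ hε h) ENNReal.toReal_nonneg

lemma lintegral_cond_le [IsProbabilityMeasure P] {A : Set Ω} (hA : MeasurableSet A)
    (hε : 0 < ε) (h : ε ≤ P.real A)
    {F G : Ω → ENNReal} (hFG : ∀ ω ∈ A, F ω ≤ G ω) :
    ∫⁻ ω, F ω ∂(P[|A]) ≤ ENNReal.ofReal ε⁻¹ * ∫⁻ ω, G ω ∂P := by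
  rw [ProbabilityTheory.cond, lintegral_smul_measure, smul_eq_mul]
  have h1 : (P A)⁻¹ ≤ ENNReal.ofReal ε⁻¹ := by
    rw [ENNReal.ofReal_inv_of_pos hε, ENNReal.inv_le_inv, ← ofReal_measureReal]
    exact ENNReal.ofReal_le_ofReal h
  exact mul_le_mul' h1 ((setLIntegral_mono' hA hFG).trans (setLIntegral_le_lintegral _ _))

lemma aemeasurable_cond {β : Type*} [MeasurableSpace β] [Zero β]
    (hm : ∀ j, Measurable (x j)) {F : (Fin n → EuclideanSpace ℝ (Fin p)) → β}
    (hF : Measurable ((goodData n p lam ε).indicator F)) :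
    AEMeasurable (fun ω => F fun j => x j ω) (P[|goodEvent x lam ε]) := by
  refine ⟨_, hF.comp (measurable_data hm), ?_⟩
  filter_upwards [ae_cond_mem (μ := P) (measurableSet_goodEvent (lam := lam) (ε := ε) hm)] with ω hω
  have : (fun j => x j ω) ∈ goodData n p lam ε := hω
  simp [this]

end GoodEvent

/-! ### The size of `xᵢᵀ y₋ᵢ(t)` -/

section Bridge

variable {n p : ℕ} {f : ℝ → ℝ} {lam ε : ℝ}

lemma supBridge_le {x : Fin n → EuclideanSpace ℝ (Fin p)} (hn : 0 < n) (hε : 0 < ε)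
    (hlam : 0 < lam) (hfl : ∀ u v, |f u - f v| ≤ lam * |u - v|)
    (hx : lam / n * gramNorm x ≤ 1 - ε) (i : Fin n) :
    supBridge f x i ≤ ENNReal.ofReal (1 + ε⁻¹) *
      ENNReal.ofReal |inner ℝ (x i) (leaveOneOut f x i)| + ENNReal.ofReal (|f 0| / (lam * ε)) := by
  refine iSup_le fun t => ?_
  have hn' : (0 : ℝ) < n := by exact_mod_cast hn
  rw [← ENNReal.ofReal_mul (by positivity), ← ENNReal.ofReal_add (by positivity) (by positivity)]
  refine ENNReal.ofReal_le_ofReal ?_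
  set z := leaveOneOut f x i with hz
  set s := |inner ℝ (x i) z| with hs
  have h1 := norm_bridge_sub_bridge_le hε hlam.le hfl hx i (s := 0) ⟨le_rfl, zero_le_one⟩ t.2
  rw [← leaveOneOut_eq_bridge, ← hz, sub_zero, abs_of_nonneg t.2.1] at h1
  have hfs : |f (inner ℝ (x i) z)| ≤ |f 0| + lam * s := by
    have h2 := hfl (inner ℝ (x i) z) 0
    rw [sub_zero, ← hs] at h2
    have h3 := abs_add_le (f (inner ℝ (x i) z) - f 0) (f 0)
    rw [sub_add_cancel] at h3
    linarith
  have hxi : ‖x i‖ ^ 2 ≤ n / lam := (norm_sq_le_gramNorm x i).trans (gramNorm_le_div hn hε hlam hx)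
  have h4 : |inner ℝ (x i) (bridge f x i t)| ≤ s + ‖x i‖ * ‖bridge f x i t - z‖ := by
    have h5 := abs_add_le (inner ℝ (x i) z) (inner ℝ (x i) (bridge f x i t - z))
    rw [← inner_add_right, add_sub_cancel] at h5
    -- Cauchy–Schwarz is affordable here: the bridge moves by $O(\|x_i\|/n)$ times
    -- $|f(x_i^TY_{-i})|$, and $\|x_i\|^2\le n/\lambda$.
    exact h5.trans (by gcongr; exact abs_real_inner_le_norm _ _)
  refine h4.trans ?_
  have h6 : ‖x i‖ * ‖bridge f x i t - z‖ ≤ ε⁻¹ * (1 / lam * (|f 0| + lam * s)) := by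
    calc _ ≤ ‖x i‖ * (ε⁻¹ * (t / n * (|f (inner ℝ (x i) z)| * ‖x i‖))) := by gcongr
      _ = ε⁻¹ * (t * (‖x i‖ ^ 2 / n) * |f (inner ℝ (x i) z)|) := by ring
      _ ≤ ε⁻¹ * (1 * ((n / lam) / n) * (|f 0| + lam * s)) := by
          have := t.2.1
          gcongr
          exact t.2.2
      _ = _ := by field_simp
  have e : ε⁻¹ * (1 / lam * (|f 0| + lam * s)) = ε⁻¹ * s + |f 0| / (lam * ε) := by
    field_simp
    ring
  linarith

variable {Ω : Type*} [MeasurableSpace Ω] {P : Measure Ω} [IsProbabilityMeasure P]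
  {x : Fin n → Ω → EuclideanSpace ℝ (Fin p)} {C c m : ℝ}

/-- A bound for `𝔼 |xᵢᵀ Y₋ᵢ|`, and with it for `M_i`. -/
def bridgeConst (C c m lam ε f₀ : ℝ) : ℝ :=
  (1 + ε⁻¹) * ((ε⁻¹ * (|f₀| * √lam⁻¹) + 1) + linearFourthMoment C c m *
    (ε⁻¹ * (|f₀| * √lam⁻¹) + 1) ^ 4 / (ε⁻¹ * (|f₀| * √lam⁻¹) + 1) ^ 3)

lemma lintegral_supBridge_le (hn : 0 < n) (hε : 0 < ε) (hlam : 0 < lam) (hC : 0 < C) (hc : 0 < c)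
    (hf : Continuous f) (hfl : ∀ u v, |f u - f v| ≤ lam * |u - v|)
    (hm : ∀ j, Measurable (x j)) (hindep : iIndepFun x P)
    (hX : ∀ i, ConcentratedWith P (x i) C c) (hmean : ∀ i, ‖∫ ω, x i ω ∂P‖ ≤ m)
    (hA : ε ≤ P.real (goodEvent x lam ε)) (i : Fin n) :
    ∫⁻ ω, supBridge f (fun j => x j ω) i ∂(P[|goodEvent x lam ε])
      ≤ ENNReal.ofReal ε⁻¹ * (ENNReal.ofReal (bridgeConst C c m lam ε (f 0))
        + ENNReal.ofReal (|f 0| / (lam * ε))) := by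
  -- The first summand bounds $\|Y_{-i}\|$ on good data; adding $1$ keeps $\rho$ positive when
  -- $f(0)=0$.
  set ρ := ε⁻¹ * (|f 0| * √lam⁻¹) + 1 with hρ
  have hρ0 : 0 < ρ := by positivity
  set Y : (Fin n → EuclideanSpace ℝ (Fin p)) → EuclideanSpace ℝ (Fin p) :=
    (goodData n p lam ε).indicator fun x => leaveOneOut f x i with hY
  have hYm : Measurable Y := measurable_indicator_leaveOneOut hf hε hlam.le hfl i
  have hYb : ∀ a, ‖Y a‖ ≤ ρ := fun a => by
    by_cases ha : a ∈ goodData n p lam ε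
    · rw [hY, Set.indicator_of_mem ha]
      exact (norm_leaveOneOut_le hn hε hlam hfl ha i).trans (by linarith)
    · rw [hY, Set.indicator_of_notMem ha, norm_zero]
      exact hρ0.le
  set ξ : Ω → Fin n → EuclideanSpace ℝ (Fin p) :=
    fun ω => Function.update (fun j => x j ω) i 0 with hξ
  have hξm : Measurable ξ := measurable_update_data hm i
  have hK := linearFourthMoment_nonneg C c m
  have hfrozen : ∫⁻ ω, ENNReal.ofReal |inner ℝ (x i ω) (Y (ξ ω))| ∂P
      ≤ ENNReal.ofReal (ρ + linearFourthMoment C c m * ρ ^ 4 / ρ ^ 3) := by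
    refine lintegral_le_of_indepFun (F := fun q => ENNReal.ofReal |inner ℝ q.2 (Y q.1)|)
      hξm (hm i) (indepFun_update hindep hm i) ?_ fun a => ?_
    · have h1 : Measurable fun q : (Fin n → EuclideanSpace ℝ (Fin p)) ×
          EuclideanSpace ℝ (Fin p) => inner ℝ q.2 (Y q.1) :=
        measurable_snd.inner (hYm.comp measurable_fst)
      exact ENNReal.measurable_ofReal.comp h1.norm
    · refine lintegral_le_of_pow_four_le hρ0 (by positivity) (fun ω => abs_nonneg _) ?_
      have := (hX i).lintegral_pow_four_le hC hc (hm i) (hmean i) (φ := innerSL ℝ (Y a)) hρ0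
        (by rw [innerSL_apply_norm]; exact hYb a)
      simpa only [innerSL_apply_apply, real_inner_comm] using this
  have hbound := lintegral_cond_le (P := P) (measurableSet_goodEvent hm) hε hA
    (F := fun ω => supBridge f (fun j => x j ω) i)
    (G := fun ω => ENNReal.ofReal (1 + ε⁻¹) * ENNReal.ofReal |inner ℝ (x i ω) (Y (ξ ω))|
      + ENNReal.ofReal (|f 0| / (lam * ε))) fun ω hω => by
    have hω' : (fun j => x j ω) ∈ goodData n p lam ε := hω
    have e : Y (ξ ω) = leaveOneOut f (fun j => x j ω) i := by
      rw [hY, Set.indicator_of_mem (update_mem_goodData hlam.le hω' i), leaveOneOut_update]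
    rw [e]
    exact supBridge_le hn hε hlam hfl hω i
  refine hbound.trans ?_
  rw [lintegral_add_right _ measurable_const, lintegral_const, measure_univ, mul_one,
    lintegral_const_mul' _ _ ENNReal.ofReal_ne_top, bridgeConst, ENNReal.ofReal_mul (by positivity)]
  gcongr

end Bridge

/-! ### Concentration of the residual -/

section Residual

variable {n p : ℕ} {f : ℝ → ℝ} {lam ε : ℝ}

/-- The `ℓ⁴` norm of the forms `xⱼᵀ Q₋ᵢ v`, `j ≠ i`. -/
def resolventQuartic (f : ℝ → ℝ) (x : Fin n → EuclideanSpace ℝ (Fin p)) (i : Fin n)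
    (v : EuclideanSpace ℝ (Fin p)) : ℝ :=
  quarticNorm (otherForms x i
    (Matrix.toEuclideanCLM (𝕜 := ℝ) (n := Fin p) (resolvent f x i) v))

lemma resolventQuartic_update (f : ℝ → ℝ) (x : Fin n → EuclideanSpace ℝ (Fin p)) (i : Fin n)
    (v : EuclideanSpace ℝ (Fin p)) :
    resolventQuartic f (Function.update x i 0) i v = resolventQuartic f x i v := by
  rw [resolventQuartic, resolvent_update, resolventQuartic]
  unfold otherForms
  rw [Function.update_idem]

/-- The data are frozen and good, and $v$ alone varies: the map is an $\ell^4$ norm composed with a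
linear map. -/
lemma lipschitzWith_resolventQuartic {x : Fin n → EuclideanSpace ℝ (Fin p)} (hn : 0 < n)
    (hε : 0 < ε) (hlam : 0 < lam) (hflam : ∀ u, |deriv f u| ≤ lam)
    (hx : lam / n * gramNorm x ≤ 1 - ε) (i : Fin n) :
    LipschitzWith (√(n / lam) / ε).toNNReal (resolventQuartic f x i) := by
  refine LipschitzWith.of_le_add_mul _ fun u v => ?_
  rw [Real.coe_toNNReal _ (by positivity), dist_eq_norm]
  have e : otherForms x i (Matrix.toEuclideanCLM (𝕜 := ℝ) (n := Fin p) (resolvent f x i) u)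
      = fun j => otherForms x i
          (Matrix.toEuclideanCLM (𝕜 := ℝ) (n := Fin p) (resolvent f x i) v) j
        + otherForms x i
          (Matrix.toEuclideanCLM (𝕜 := ℝ) (n := Fin p) (resolvent f x i) (u - v)) j := by
    ext j
    simp only [otherForms]
    rw [← inner_add_right, ← map_add, add_sub_cancel]
  rw [resolventQuartic, e]
  refine (quarticNorm_add_le _ _).trans (add_le_add le_rfl ?_)
  refine (quarticNorm_otherForms_le hn hε hlam hx i _).trans ?_
  calc _ ≤ √(n / lam) * (ε⁻¹ * ‖u - v‖) := by
        gcongr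
        exact norm_resolvent_le hε hlam.le hflam hx i _
    _ = _ := by ring

lemma measurableSet_resolventQuartic (hf : Continuous f) (hf' : Continuous (deriv f)) (hε : 0 < ε)
    (hlam : 0 ≤ lam) (hfl : ∀ u v, |f u - f v| ≤ lam * |u - v|) (i : Fin n) (τ : ℝ) :
    MeasurableSet {q : (Fin n → EuclideanSpace ℝ (Fin p)) × EuclideanSpace ℝ (Fin p) |
      q.1 ∈ goodData n p lam ε ∧ τ ≤ resolventQuartic f q.1 i q.2} := by
  have h1 := measurable_resolvent_apply (p := p) hf hf' hε hlam hfl i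
  have h2 : Measurable fun q : (Fin n → EuclideanSpace ℝ (Fin p)) × EuclideanSpace ℝ (Fin p) =>
      quarticNorm (otherForms q.1 i ((goodData n p lam ε).indicator (fun x =>
        Matrix.toEuclideanCLM (𝕜 := ℝ) (n := Fin p) (resolvent f x i) q.2) q.1)) := by
    refine measurable_quarticNorm.comp (measurable_pi_lambda _ fun j => ?_)
    unfold otherForms
    refine Measurable.inner ?_ h1
    by_cases hj : j = i
    · subst hj; simp
    · simp only [Function.update_of_ne hj]
      fun_prop
  have h3 : MeasurableSet {q : (Fin n → EuclideanSpace ℝ (Fin p)) × EuclideanSpace ℝ (Fin p) |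
      q.1 ∈ goodData n p lam ε} := measurable_fst (measurableSet_goodData lam ε)
  convert h3.inter (measurableSet_le (measurable_const (a := τ)) h2) using 1
  ext q
  simp only [Set.mem_ofPred_eq, Set.mem_inter_iff]
  refine and_congr_right fun hq => ?_
  rw [Set.indicator_of_mem hq, resolventQuartic]

variable {Ω : Type*} [MeasurableSpace Ω] {P : Measure Ω} [IsProbabilityMeasure P]
  {x : Fin n → Ω → EuclideanSpace ℝ (Fin p)} {C c m : ℝ}

/-- Each form $v\mapsto a_j^TQ_{-i}v$ has norm at most $l=\sqrt{n/\lambda}/\varepsilon$, so the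
fourth powers sum to at most $nKl^4$ in mean. The factor $n^{1/4}$ replaces the $n^{1/2}$ that an
$\ell^2$ norm would give. -/
lemma integral_resolventQuartic_le {a : Fin n → EuclideanSpace ℝ (Fin p)}
    {Z : Ω → EuclideanSpace ℝ (Fin p)} (hn : 0 < n) (hε : 0 < ε) (hlam : 0 < lam) (hC : 0 < C)
    (hc : 0 < c) (hflam : ∀ u, |deriv f u| ≤ lam) (hm : Measurable Z)
    (hZ : ConcentratedWith P Z C c) (hmean : ‖∫ ω, Z ω ∂P‖ ≤ m)
    (ha : lam / n * gramNorm a ≤ 1 - ε) (i : Fin n) :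
    ∫ ω, resolventQuartic f a i (Z ω) ∂P
      ≤ √(n / lam) / ε * ((1 + linearFourthMoment C c m) * √(√n)) := by
  have hn' : (0 : ℝ) < n := by exact_mod_cast hn
  set K := linearFourthMoment C c m with hKdef
  have hK : 0 ≤ K := linearFourthMoment_nonneg C c m
  set l := √(n / lam) / ε with hl
  have hl0 : 0 < l := by positivity
  set s := √(√n) with hs
  have hs0 : 0 < s := by positivity
  have hs4 : s ^ 4 = n := by
    rw [show 4 = 2 * 2 by norm_num, pow_mul, hs, Real.sq_sqrt (by positivity),
      Real.sq_sqrt hn'.le]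
  have h4 : ∫⁻ ω, ENNReal.ofReal (resolventQuartic f a i (Z ω) ^ 4) ∂P
      ≤ ENNReal.ofReal (n * (K * l ^ 4)) := by
    let φ : Fin n → EuclideanSpace ℝ (Fin p) →L[ℝ] ℝ := fun j =>
      (innerSL ℝ (Function.update a i 0 j)).comp
        (Matrix.toEuclideanCLM (𝕜 := ℝ) (n := Fin p) (resolvent f a i))
    have hφ : ∀ j, ‖φ j‖ ≤ l := fun j => by
      refine ContinuousLinearMap.opNorm_le_bound _ hl0.le fun v => ?_
      refine (norm_inner_le_norm (𝕜 := ℝ) (Function.update a i 0 j)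
        (Matrix.toEuclideanCLM (𝕜 := ℝ) (n := Fin p) (resolvent f a i) v)).trans ?_
      calc _ ≤ √(n / lam) * (ε⁻¹ * ‖v‖) := by
            gcongr
            · exact norm_col_le hn hε hlam (update_mem_goodData hlam.le ha i) j
            · exact norm_resolvent_le hε hlam.le hflam ha i v
        _ = _ := by rw [hl]; ring
    have e : ∀ ω, ENNReal.ofReal (resolventQuartic f a i (Z ω) ^ 4)
        = ∑ j, ENNReal.ofReal (|φ j (Z ω)| ^ 4) := fun ω => by
      rw [resolventQuartic, quarticNorm_pow_four, ENNReal.ofReal_sum_of_nonneg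
        fun j _ => by positivity]
      refine Finset.sum_congr rfl fun j _ => ?_
      rw [Even.pow_abs (by decide)]
      rfl
    simp_rw [e]
    rw [lintegral_finsetSum _ fun j _ => by
      have := ((φ j).continuous.measurable.comp hm).norm
      exact ENNReal.measurable_ofReal.comp (this.pow_const 4)]
    calc _ ≤ ∑ j : Fin n, ENNReal.ofReal (K * l ^ 4) :=
          Finset.sum_le_sum fun j _ => hZ.lintegral_pow_four_le hC hc hm hmean hl0 (hφ j)
      _ = _ := by
          rw [Finset.sum_const, Finset.card_univ, Fintype.card_fin, nsmul_eq_mul,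
            ENNReal.ofReal_mul hn'.le, ENNReal.ofReal_natCast]
  -- With $\theta=n^{1/4}l$ both terms of the bound scale as $n^{1/4}l$.
  have h1 := lintegral_le_of_pow_four_le (P := P) (W := fun ω => resolventQuartic f a i (Z ω))
    (θ := s * l) (by positivity) (by positivity) (fun ω => quarticNorm_nonneg _) h4
  obtain ⟨hi, -⟩ := hZ.of_lipschitzWith (Real.toNNReal_pos.2 hl0)
    (lipschitzWith_resolventQuartic hn hε hlam hflam ha i)
  rw [← ofReal_integral_eq_lintegral_ofReal hi
    (Filter.Eventually.of_forall fun ω => quarticNorm_nonneg _),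
    ENNReal.ofReal_le_ofReal_iff (by positivity)] at h1
  refine h1.trans (le_of_eq ?_)
  rw [← hs4]
  field_simp

lemma measureReal_resolventQuartic_le (hn : 0 < n) (hε : 0 < ε) (hlam : 0 < lam) (hC : 0 < C)
    (hc : 0 < c) (hf : Continuous f) (hf' : Continuous (deriv f))
    (hflam : ∀ u, |deriv f u| ≤ lam) (hfl : ∀ u v, |f u - f v| ≤ lam * |u - v|)
    (hm : ∀ j, Measurable (x j)) (hindep : iIndepFun x P)
    (hX : ∀ i, ConcentratedWith P (x i) C c) (hmean : ∀ i, ‖∫ ω, x i ω ∂P‖ ≤ m)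
    (i : Fin n) {t : ℝ} (ht : 0 < t) :
    P.real (goodEvent x lam ε ∩ {ω | √(n / lam) / ε *
        ((1 + linearFourthMoment C c m) * √(√n) + t)
          ≤ resolventQuartic f (fun j => x j ω) i (x i ω)})
      ≤ C * Real.exp (-(t / c) ^ 2) := by
  have hn' : (0 : ℝ) < n := by exact_mod_cast hn
  set l := √(n / lam) / ε with hl
  have hl0 : 0 < l := by positivity
  set τ := l * ((1 + linearFourthMoment C c m) * √(√n) + t) with hτ
  refine ENNReal.toReal_le_of_le_ofReal (by positivity) ?_
  have key := measure_le_of_indepFun (P := P) (measurable_update_data hm i) (hm i)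
    (indepFun_update hindep hm i)
    (measurableSet_resolventQuartic (p := p) hf hf' hε hlam.le hfl i τ)
    (δ := ENNReal.ofReal (C * Real.exp (-(t / c) ^ 2))) fun a => by
    by_cases ha : a ∈ goodData n p lam ε
    · rw [← ofReal_measureReal]
      refine ENNReal.ofReal_le_ofReal ?_
      have h1 := integral_resolventQuartic_le hn hε hlam hC hc hflam (hm i) (hX i) (hmean i) ha i
      obtain ⟨-, h2⟩ := (hX i).of_lipschitzWith (Real.toNNReal_pos.2 hl0)
        (lipschitzWith_resolventQuartic hn hε hlam hflam ha i)
      refine le_trans (measureReal_mono fun ω hω => ?_) (h2 t ht)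
      have h3 : τ ≤ resolventQuartic f a i (x i ω) := hω.2
      rw [Set.mem_ofPred_eq]
      refine le_trans ?_ (le_abs_self _)
      rw [Real.coe_toNNReal _ hl0.le]
      rw [hτ, mul_add] at h3
      linarith
    · have : {ω | (a, x i ω) ∈ {q : (Fin n → EuclideanSpace ℝ (Fin p)) ×
          EuclideanSpace ℝ (Fin p) | q.1 ∈ goodData n p lam ε ∧
            τ ≤ resolventQuartic f q.1 i q.2}} = ∅ := by
        ext ω
        simp [ha]
      rw [this, measure_empty]
      exact zero_le
  -- Erasing $x_i$ from the data changes neither goodness nor $Q_{-i}$, so the actual event lies in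
  -- the frozen one.
  refine (measure_mono fun ω hω => ?_).trans key
  refine ⟨update_mem_goodData hlam.le hω.1 i, ?_⟩
  rw [resolventQuartic_update]
  exact hω.2

/-- The constant `D` in `‖Y - Y₋ᵢ - (1/n) f(xᵢᵀ Y) Q₋ᵢ xᵢ‖ ≤ D H² (n / lam)^{-3/2}`, where `H` is
the normalized `ℓ⁴` norm of the forms `xⱼᵀ Q₋ᵢ xᵢ`. -/
def expansionConst (lam ε L B : ℝ) : ℝ :=
  (4 * (L / (ε * lam)) + 16 * (L / (ε * lam)) ^ 2 * (2 * B / (ε * lam))) * (B / (lam * ε)) ^ 2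

lemma expansionConst_pos {L B : ℝ} (hlam : 0 < lam) (hε : 0 < ε) (hL : 0 < L) (hB : 0 < B) :
    0 < expansionConst lam ε L B := by
  unfold expansionConst
  positivity

/-- If the residual exceeds `τ`, then the `ℓ⁴` norm of the forms `xⱼᵀ Q₋ᵢ xᵢ` exceeds its mean
substantially, as soon as `n τ` is larger than a constant. -/
lemma le_resolventQuartic_of_le_residualNorm {L B κ τ : ℝ} {x : Fin n → EuclideanSpace ℝ (Fin p)}
    (hn : 0 < n) (hε : 0 < ε) (hlam : 0 < lam)
    (hf : Differentiable ℝ f) (hf' : Differentiable ℝ (deriv f))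
    (hflam : ∀ u, |deriv f u| ≤ lam) (hL0 : 0 < L) (hL : ∀ u, |deriv (deriv f) u| ≤ L)
    (hB0 : 0 < B) (hB : ∀ u, |f u| ≤ B)
    (hx : lam / n * gramNorm x ≤ 1 - ε) (i : Fin n) (hτ0 : 0 < τ) (hτ : τ ≤ residualNorm f x i)
    (hτn : 4 * lam * expansionConst lam ε L B * κ ^ 2 * √lam ≤ n * τ) :
    √(n / lam) / ε * (κ * √(√n) + √(n * τ * √(n / lam) / (4 * lam * expansionConst lam ε L B)))
      ≤ resolventQuartic f x i (x i) := by
  have hn' : (0 : ℝ) < n := by exact_mod_cast hn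
  have h := hτ.trans (residualNorm_le hn hε hlam hf hf' hflam hL0 hL hB hx i)
  have hD := expansionConst_pos hlam hε hL0 hB0
  have hq0 : 0 ≤ resolventQuartic f x i (x i) := quarticNorm_nonneg _
  change τ ≤ _ * (B / n * resolventQuartic f x i (x i)) ^ 2 at h
  set D := expansionConst lam ε L B with hDdef
  set g := √(n / lam) with hg
  have hg0 : 0 < g := by positivity
  have hng : (n : ℝ) = lam * g ^ 2 := by
    rw [hg, Real.sq_sqrt (by positivity)]
    field_simp
  set q := resolventQuartic f x i (x i) with hq
  set H := q * ε / g with hH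
  have hH0 : 0 ≤ H := by positivity
  have hqH : q = g / ε * H := by
    rw [hH]
    field_simp
  rw [hqH]
  refine mul_le_mul_of_nonneg_left ?_ (by positivity)
  -- This $t$ is half of the lower bound $\sqrt{\tau g^3/D}$ for $H$; the assumption on $n\tau$ says
  -- that the other half covers $\kappa n^{1/4}$.
  set t := √(n * τ * g / (4 * lam * D)) with ht
  have ht2 : t ^ 2 = n * τ * g / (4 * lam * D) := Real.sq_sqrt (by positivity)
  have h1 : τ ≤ D * H ^ 2 / g ^ 3 := by
    refine h.trans (le_of_eq ?_)
    rw [hqH, hDdef, expansionConst, hng]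
    field_simp
  have h2 : 2 * t ≤ H := by
    refine le_of_sq_le_sq ?_ hH0
    rw [mul_pow, ht2]
    rw [le_div_iff₀ (by positivity)] at h1
    have : 2 ^ 2 * (n * τ * g / (4 * lam * D)) = τ * g ^ 3 / D := by
      rw [hng]
      field_simp
      ring
    rw [this, div_le_iff₀ hD]
    linarith
  have h3 : κ * √(√n) ≤ t := by
    refine le_of_sq_le_sq ?_ (Real.sqrt_nonneg _)
    rw [mul_pow, Real.sq_sqrt (Real.sqrt_nonneg _), ht2, le_div_iff₀ (by positivity)]
    have e : √(n : ℝ) = √lam * g := by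
      rw [hg, ← Real.sqrt_mul hlam.le]
      congr 1
      field_simp
    rw [e]
    calc κ ^ 2 * (√lam * g) * (4 * lam * D) = 4 * lam * D * κ ^ 2 * √lam * g := by ring
      _ ≤ _ := by gcongr
  linarith

lemma cond_real_residualNorm_le {L B τ : ℝ} (hn : 0 < n) (hε : 0 < ε) (hlam : 0 < lam)
    (hC : 0 < C) (hc : 0 < c) (hf : Differentiable ℝ f) (hf' : Differentiable ℝ (deriv f))
    (hflam : ∀ u, |deriv f u| ≤ lam) (hL0 : 0 < L) (hL : ∀ u, |deriv (deriv f) u| ≤ L)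
    (hB0 : 0 < B) (hB : ∀ u, |f u| ≤ B)
    (hm : ∀ j, Measurable (x j)) (hindep : iIndepFun x P)
    (hX : ∀ i, ConcentratedWith P (x i) C c) (hmean : ∀ i, ‖∫ ω, x i ω ∂P‖ ≤ m)
    (hA : ε ≤ P.real (goodEvent x lam ε)) (i : Fin n) (hτ0 : 0 < τ)
    (hτn : 4 * lam * expansionConst lam ε L B * (1 + linearFourthMoment C c m) ^ 2 * √lam
      ≤ n * τ) :
    (P[|goodEvent x lam ε]).real {ω | τ ≤ residualNorm f (fun j => x j ω) i}
      ≤ ε⁻¹ * (C * Real.exp (-((n * τ) ^ 2 /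
        (4 * lam ^ 2 * expansionConst lam ε L B * (2 * B / (ε * lam)) * c ^ 2)))) := by
  have hn' : (0 : ℝ) < n := by exact_mod_cast hn
  have hfl := abs_sub_le_of_deriv_le hf hflam
  have hD := expansionConst_pos hlam hε hL0 hB0
  have hK := linearFourthMoment_nonneg C c m
  refine (cond_real_le (measurableSet_goodEvent hm) hε hA).trans ?_
  refine mul_le_mul_of_nonneg_left ?_ (by positivity)
  -- Below the crude bound, $n\tau\le\lambda gb$ with $b=2B/(\varepsilon\lambda)$, so the exponent,
  -- linear in $\tau$ and proportional to $n\tau g$, dominates $(n\tau)^2$. Above it the event is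
  -- empty.
  by_cases hτ : τ ≤ 2 * B / (ε * lam) / √(n / lam)
  · have hsub : goodEvent x lam ε ∩ {ω | τ ≤ residualNorm f (fun j => x j ω) i} ⊆
        goodEvent x lam ε ∩ {ω | √(n / lam) / ε * ((1 + linearFourthMoment C c m) * √(√n) +
          √(n * τ * √(n / lam) / (4 * lam * expansionConst lam ε L B)))
            ≤ resolventQuartic f (fun j => x j ω) i (x i ω)} := fun ω hω =>
      ⟨hω.1, le_resolventQuartic_of_le_residualNorm hn hε hlam hf hf' hflam hL0 hL hB0 hB
        hω.1 i hτ0 hω.2 hτn⟩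
    refine (measureReal_mono hsub).trans ?_
    set D := expansionConst lam ε L B with hDdef
    set b := 2 * B / (ε * lam) with hb
    have hb0 : 0 < b := by positivity
    have hg0 : 0 < √(n / lam) := by positivity
    refine (measureReal_resolventQuartic_le hn hε hlam hC hc hf.continuous hf'.continuous hflam hfl
      hm hindep hX hmean i (by positivity)).trans ?_
    gcongr
    rw [div_pow, Real.sq_sqrt (by positivity)]
    rw [le_div_iff₀ hg0] at hτ
    have hng : (n : ℝ) = lam * √(n / lam) ^ 2 := by
      rw [Real.sq_sqrt (by positivity)]
      field_simp
    have h1 : n * τ ≤ lam * √(n / lam) * b := by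
      calc n * τ = lam * √(n / lam) * (τ * √(n / lam)) := by
            nth_rewrite 1 [hng]
            ring
        _ ≤ _ := by gcongr
    calc (n * τ) ^ 2 / (4 * lam ^ 2 * D * b * c ^ 2)
        = n * τ * (n * τ) / (4 * lam ^ 2 * D * b * c ^ 2) := by rw [sq]
      _ ≤ n * τ * (lam * √(n / lam) * b) / (4 * lam ^ 2 * D * b * c ^ 2) := by gcongr
      _ = _ := by field_simp
  · have : goodEvent x lam ε ∩ {ω | τ ≤ residualNorm f (fun j => x j ω) i} = ∅ := by
      ext ω
      simp only [Set.mem_inter_iff, Set.mem_ofPred_eq, Set.mem_empty_iff_false, iff_false, not_and,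
        not_le]
      intro hω
      push Not at hτ
      exact (residualNorm_le_crude hn hε hlam hf hflam hB hω i).trans_lt hτ
    rw [this, measureReal_empty]
    positivity

end Residual

end RobustRegression

end

/-! ### Assembly of the estimates with constants uniform in the family. -/

theorem mainTheorem12
    {S : Type*} {Ω : S → Type*} [∀ s, MeasurableSpace (Ω s)]
    (P : ∀ s, Measure (Ω s)) [∀ s, IsProbabilityMeasure (P s)]
    (n p : S → ℕ)
    (x : ∀ s, Fin (n s) → Ω s → EuclideanSpace ℝ (Fin (p s)))
    (hmeas : ∀ s j, Measurable (x s j))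
    -- `X ∝ 𝓔₂` for the Frobenius norm
    (hconc : RobustRegression.LipschitzConcentrated
      (E := fun s => PiLp 2 (fun _ : Fin (n s) => EuclideanSpace ℝ (Fin (p s))))
      P (fun s ω => WithLp.toLp 2 (fun j => x s j ω)) 2 (fun _ => 1))
    -- independent columns
    (hindep : ∀ s, iIndepFun (x s) (P s))
    -- `n` and `p` are of the same order
    (hnp : ∃ a > 0, ∃ b > 0, ∀ s, a * (p s : ℝ) ≤ n s ∧ (n s : ℝ) ≤ b * p s)
    -- bounded means, energies bounded from below
    (hmean : ∃ m : ℝ, ∀ s j, ‖∫ ω, x s j ω ∂(P s)‖ ≤ m)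
    (henergy : ∃ κ > 0, ∀ s j,
      κ ≤ 1 / (n s : ℝ) * (RobustRegression.secondMoment (P s) (x s j)).trace)
    (f : ℝ → ℝ) (hf : Differentiable ℝ f) (hf' : Differentiable ℝ (deriv f))
    (lam : ℝ) (hlam : 0 < lam) (hflam : ∀ u, |deriv f u| ≤ lam)
    (hf'' : ∃ L : ℝ, ∀ u, |deriv (deriv f) u| ≤ L)
    (ε : ℝ) (hε : 0 < ε)
    (hcontr : ∀ s, 2 * ε ≤
      1 - lam / n s * ∫ ω, RobustRegression.gramNorm (fun j => x s j ω) ∂(P s)) :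
    -- on the event `𝓐_Y`, all the objects are well defined
    (∀ s, ∀ ω ∈ RobustRegression.goodEvent (x s) lam ε,
      (∃! y, y = RobustRegression.regressionMap f (fun j => x s j ω) y) ∧
      ∀ i, (∃! y, y = RobustRegression.leaveOneOutMap f (fun j => x s j ω) i y) ∧
        (∀ t ∈ Set.Icc (0 : ℝ) 1,
          ∃! y, y = RobustRegression.bridgeMap f (fun j => x s j ω) i t y) ∧
        IsUnit (RobustRegression.preResolvent f (fun j => x s j ω) i)) ∧
    -- `𝓐_Y` has overwhelming probability
    (∃ C > 0, ∃ c > 0, ∀ s, P s (RobustRegression.goodEvent (x s) lam ε) ≠ 0 ∧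
      (P s).real (RobustRegression.goodEvent (x s) lam ε)ᶜ ≤ C * Real.exp (-(c * n s))) ∧
    -- `M_i ≤ O(1)`
    (∃ K : NNReal, ∀ s i,
      AEMeasurable (fun ω => RobustRegression.supBridge f (fun j => x s j ω) i)
        ((P s)[|RobustRegression.goodEvent (x s) lam ε]) ∧
      ∫⁻ ω, RobustRegression.supBridge f (fun j => x s j ω) i
        ∂((P s)[|RobustRegression.goodEvent (x s) lam ε]) ≤ K) ∧
    -- `‖Y - Y₋ᵢ - (1/n) f(xᵢᵀ Y) Q₋ᵢ xᵢ‖ ∈ 0 ± 𝓔₂(1/n) | e^{-n}`, uniformly in `i`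
    ((∃ B : ℝ, ∀ u, |f u| ≤ B) →
      RobustRegression.LinearlyConcentratedOn (S := Σ s, Fin (n s)) (Ω := fun k => Ω k.1)
        (E := fun _ => ℝ)
        (fun k => P k.1)
        (fun k => RobustRegression.goodEvent (x k.1) lam ε)
        (fun k ω => RobustRegression.residualNorm f (fun j => x k.1 j ω) k.2)
        (fun _ => 0) 2 (fun k => 1 / (n k.1 : ℝ)) (fun k => (n k.1 : ℝ))) := by
  obtain ⟨C, hC, c, hc, hconc⟩ := hconc
  obtain ⟨m, hmean⟩ := hmean
  obtain ⟨L₀, hL₀⟩ := hf''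
  have hfl := RobustRegression.abs_sub_le_of_deriv_le hf hflam
  have hX : ∀ s, RobustRegression.ConcentratedWith
      (E := PiLp 2 fun _ : Fin (n s) => EuclideanSpace ℝ (Fin (p s))) (P s)
      (fun ω => WithLp.toLp 2 fun j => x s j ω) C c := fun s g hg => by
    simpa only [mul_one, Real.rpow_two] using hconc s g hg
  have hcol : ∀ s i, RobustRegression.ConcentratedWith (P s) (x s i) C c :=
    fun s i => (hX s).column i
  have hint := fun s => RobustRegression.integrable_gramNorm hC hc (hX s)
  have hA := fun s => RobustRegression.le_measureReal_goodEvent (hmeas s) hlam.le hε (hint s)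
    (hcontr s)
  have hAne : ∀ s, P s (RobustRegression.goodEvent (x s) lam ε) ≠ 0 := fun s h0 => by
    have := hA s
    rw [measureReal_def, h0, ENNReal.toReal_zero] at this
    linarith
  have hgood : ∃ C > 0, ∃ c > 0, ∀ s,
      (P s).real (RobustRegression.goodEvent (x s) lam ε)ᶜ ≤ C * Real.exp (-(c * n s)) := by
    rcases isEmpty_or_nonempty S with hS | ⟨⟨s₀⟩⟩
    · exact ⟨1, one_pos, 1, one_pos, fun s => isEmptyElim s⟩
    · have hε2 : 0 ≤ 1 - 2 * ε := by
        have h0 : 0 ≤ lam / n s₀ * ∫ ω, RobustRegression.gramNorm (fun j => x s₀ j ω) ∂(P s₀) :=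
          mul_nonneg (by positivity)
            (integral_nonneg fun ω => RobustRegression.gramNorm_nonneg _)
        linarith [hcontr s₀]
      have hδ : 0 < √(1 - ε) - √(1 - 2 * ε) :=
        sub_pos.2 (Real.sqrt_lt_sqrt hε2 (by linarith))
      refine ⟨C + 1, by positivity, (√(1 - ε) - √(1 - 2 * ε)) ^ 2 / (lam * c ^ 2),
        by positivity, fun s => ?_⟩
      -- For $n=0$ the exponential equals $1$ and the trivial bound is needed; this is why the
      -- constant is $C+1$.
      rcases Nat.eq_zero_or_pos (n s) with h0 | hn
      · have h1 : (P s).real (RobustRegression.goodEvent (x s) lam ε)ᶜ ≤ 1 := measureReal_le_one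
        simp only [h0, Nat.cast_zero, mul_zero, neg_zero, Real.exp_zero, mul_one]
        linarith
      · refine (RobustRegression.measureReal_goodEvent_compl_le hn hlam hε (hX s) (hint s)
          (hcontr s)).trans ?_
        gcongr
        linarith
  refine ⟨fun s ω hω => ⟨?_, fun i => ⟨?_, fun t ht => ?_, ?_⟩⟩, ?_, ?_, ?_⟩
  · rw [RobustRegression.regressionMap_eq]
    exact RobustRegression.existsUnique_weightedMap hε hlam.le hfl hω fun j => by simp
  · rw [RobustRegression.leaveOneOutMap_eq_bridgeMap]
    exact RobustRegression.existsUnique_bridgeMap hε hlam.le hfl hω i ⟨le_rfl, zero_le_one⟩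
  · exact RobustRegression.existsUnique_bridgeMap hε hlam.le hfl hω i ht
  · exact RobustRegression.isUnit_preResolvent hε hlam.le hflam hω i
  · obtain ⟨C₂, hC₂, c₂, hc₂, h⟩ := hgood
    exact ⟨C₂, hC₂, c₂, hc₂, fun s => ⟨hAne s, h s⟩⟩
  · refine ⟨(ENNReal.ofReal ε⁻¹ * (ENNReal.ofReal
      (RobustRegression.bridgeConst C c m lam ε (f 0))
        + ENNReal.ofReal (|f 0| / (lam * ε)))).toNNReal, fun s i => ⟨?_, ?_⟩⟩
    · exact RobustRegression.aemeasurable_cond (hmeas s)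
        (RobustRegression.measurable_indicator_supBridge hf.continuous hε hlam.le hfl i)
    · rw [ENNReal.coe_toNNReal (ENNReal.mul_ne_top ENNReal.ofReal_ne_top
        (ENNReal.add_ne_top.2 ⟨ENNReal.ofReal_ne_top, ENNReal.ofReal_ne_top⟩))]
      exact RobustRegression.lintegral_supBridge_le i.pos hε hlam hC hc hf.continuous hfl (hmeas s)
        (hindep s) (hcol s) (hmean s) (hA s) i
  · rintro ⟨B₀, hB₀⟩
    obtain ⟨C₂, hC₂, c₂, hc₂, hgood⟩ := hgood
    have hL : ∀ u, |deriv (deriv f) u| ≤ |L₀| + 1 := fun u =>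
      (hL₀ u).trans ((le_abs_self _).trans (by linarith))
    have hB : ∀ u, |f u| ≤ |B₀| + 1 := fun u =>
      (hB₀ u).trans ((le_abs_self _).trans (by linarith))
    have hL0 : 0 < |L₀| + 1 := by positivity
    have hB0 : 0 < |B₀| + 1 := by positivity
    set L := |L₀| + 1
    set B := |B₀| + 1
    have hD := RobustRegression.expansionConst_pos hlam hε hL0 hB0
    set D := RobustRegression.expansionConst lam ε L B with hDdef
    set v := 4 * lam ^ 2 * D * (2 * B / (ε * lam)) * c ^ 2 with hv
    have hv0 : 0 < v := by positivity
    set θ := 4 * lam * D * (1 + RobustRegression.linearFourthMoment C c m) ^ 2 * √lam with hθ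
    -- One scale for both tails: $c'\ge\sqrt v$ serves the residual and $c'\ge1/c_2$ serves the
    -- complement of the good event.
    set c' := √v + 1 / c₂ with hc'
    have hc0 : 0 < c' := by positivity
    have hc2 : 1 / c₂ ≤ c' := le_add_of_nonneg_left (Real.sqrt_nonneg _)
    have hcv : v ≤ c' ^ 2 := by
      rw [← Real.sq_sqrt hv0.le]
      have : √v ≤ c' := le_add_of_nonneg_right (by positivity)
      gcongr
    refine ⟨fun k => ⟨RobustRegression.measurableSet_goodEvent (hmeas k.1), hAne k.1,
      (RobustRegression.aemeasurable_cond (hmeas k.1)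
        (RobustRegression.measurable_indicator_residualNorm hf.continuous hf'.continuous hε hlam.le
          hfl k.2)).aestronglyMeasurable⟩,
      C₂ + ε⁻¹ * C + Real.exp ((θ / c') ^ 2), by positivity, c', hc0, ?_⟩
    rintro ⟨s, i⟩
    have hn : 0 < n s := i.pos
    have hn' : (0 : ℝ) < n s := by exact_mod_cast hn
    refine ⟨(hgood s).trans ?_, fun φ hφ t ht => ?_⟩
    · have h1 : 0 < ε⁻¹ * C + Real.exp ((θ / c') ^ 2) := by positivity
      gcongr
      · linarith
      · rw [div_le_iff₀ hc0]
        rw [div_le_iff₀ hc₂] at hc2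
        nlinarith
    · have hsub : {ω | t ≤ |φ (RobustRegression.residualNorm f (fun j => x s j ω) i) - φ 0|}
          ⊆ {ω | t ≤ RobustRegression.residualNorm f (fun j => x s j ω) i} := fun ω hω => by
        rw [Set.mem_ofPred_eq, map_zero, sub_zero] at hω
        rw [Set.mem_ofPred_eq]
        refine hω.trans ((φ.le_opNorm _).trans ?_)
        have h0 : 0 ≤ RobustRegression.residualNorm f (fun j => x s j ω) i := norm_nonneg _
        rw [Real.norm_of_nonneg h0]
        exact mul_le_of_le_one_left h0 hφ
      have hprob : IsProbabilityMeasure ((P s)[|RobustRegression.goodEvent (x s) lam ε]) :=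
        cond_isProbabilityMeasure (hAne s)
      refine (measureReal_mono hsub).trans ?_
      have e : t / (c' * (1 / (n s : ℝ))) = n s * t / c' := by
        field_simp
      rw [e, Real.rpow_two]
      -- Below the threshold $\theta$ the bound is trivial, thanks to the summand
      -- $e^{(\theta/c')^2}$ in the constant.
      rcases le_total θ (n s * t) with hcase | hcase
      · refine (RobustRegression.cond_real_residualNorm_le hn hε hlam hC hc hf hf' hflam hL0 hL hB0
          hB (hmeas s) (hindep s) (hcol s) (hmean s) (hA s) i ht hcase).trans ?_
        rw [← mul_assoc, ← hDdef, ← hv, div_pow ((n s : ℝ) * t)]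
        have h1 : 0 < Real.exp ((θ / c') ^ 2) := Real.exp_pos _
        gcongr
        linarith
      · have h1 : 0 < C₂ + ε⁻¹ * C := by positivity
        have h2 : (n s * t / c') ^ 2 ≤ (θ / c') ^ 2 := by gcongr
        calc _ ≤ 1 := measureReal_le_one
          _ ≤ Real.exp ((θ / c') ^ 2) * Real.exp (-(n s * t / c') ^ 2) := by
            rw [← Real.exp_add, Real.one_le_exp_iff]
            linarith
          _ ≤ _ := by
            gcongr
            linarith
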